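/- Let $(M^n,g)$, $n\ge 3$, be a compact smooth Riemannian manifold (without boundary), with Ricci tensor $Ric$, scalar curvature $R$, Schouten tensor $A_g=\frac{1}{n-2}\left(Ric-\frac{R}{2(n-1)}g\right)$ and, for a fixed integer $1\le k\le n$, $\sigma_k$-curvature $\sigma_k$, i.e. the $k$-th elementary symmetric function of the eigenvalues of $g^{-1}A_g$. Suppose that $(M,g,X,\lambda)$ is a quasi $k$-Yamabe soliton: $X$ is a smooth vector field on $M$ and $m\neq 0$, $\lambda$ are real constants such that $$\tfrac12\mathcal L_Xg-\tfrac1m X^\flat\otimes X^\flat=(\sigma_k-\lambda)g .$$ Let $X=\nabla h+Y$ be the Hodge–de Rham decomposition of $X$, i.e. $h$ is a smooth function on $M$ and $Y$ is a smooth vector field on $M$ with $\operatorname{div}Y=0$. Then the soliton is gradient (that is, $X=\nabla f$ for some smooth function $f:M\to\mathbb R$) if and only if $$\int_M\Big[Ric(\nabla h,Y)+\frac1m g(\nabla^2h,X^\flat\otimes X^\flat)-\frac2m g(\nabla^2h,dh\otimes dh)+\frac1{m^2}|dh\otimes dh|^2+\frac{n}{2m}(\sigma_k-\lambda)|X|^2+\frac2m(\sigma_k-\lambda)|\nabla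 h|^2+\frac{3}{2m^2}|X|^4\Big]\,dv_g\le 0 .$$ -/

import Mathlib

open Bundle MeasureTheory
open scoped Manifold ContDiff Matrix

noncomputable section

namespace QuasiYamabe

/-- The model space `ℝⁿ`. -/
abbrev Model (n : ℕ) : Type := EuclideanSpace ℝ (Fin n)

/-- Smooth Riemannian metrics on an `n`-dimensional manifold `M` (without boundary). -/
abbrev Metric (n : ℕ) (M : Type*) [TopologicalSpace M] [ChartedSpace (Model n) M]
    [IsManifold (𝓡 n) ∞ M] : Type _ :=
  ContMDiffRiemannianMetric (𝓡 n) ∞ (Model n) (fun x : M ↦ TangentSpace (𝓡 n) x)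

/-- Vector fields on `M`, with no regularity imposed. -/
abbrev VField (n : ℕ) (M : Type*) [TopologicalSpace M] [ChartedSpace (Model n) M] : Type _ :=
  (x : M) → TangentSpace (𝓡 n) x

/-- The partial derivative `∂ᵢ f` of a function on `ℝⁿ`. -/
def pd {n : ℕ} (i : Fin n) (f : Model n → ℝ) (y : Model n) : ℝ :=
  fderiv ℝ f y (EuclideanSpace.single i 1)

section

variable {n : ℕ} {M : Type*} [TopologicalSpace M] [ChartedSpace (Model n) M]

instance instFiniteDimensionalTangent (x : M) : FiniteDimensional ℝ (TangentSpace (𝓡 n) x) :=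
  inferInstanceAs (FiniteDimensional ℝ (EuclideanSpace ℝ (Fin n)))

/-- A vector field is smooth if it is smooth as a section of the tangent bundle. -/
def IsSmoothField [IsManifold (𝓡 n) ∞ M] (X : VField n M) : Prop :=
  ContMDiff (𝓡 n) (𝓡 n).tangent ∞ (fun x ↦ (⟨x, X x⟩ : TangentBundle (𝓡 n) M))

/-! ### Coordinate expressions

For `c : M`, the preferred chart `φ` at `c` gives local coordinates; `y` ranges over the target of
`φ`, an open subset of `ℝⁿ`, and stands for the point `φ⁻¹ y` of `M`. -/

/-- The coordinate vector field `∂ᵢ` of the chart at `c`, at the point `φ⁻¹ y`. -/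
def coordVec (c : M) (y : Model n) (i : Fin n) :
    TangentSpace (𝓡 n) ((extChartAt (𝓡 n) c).symm y) :=
  mfderiv 𝓘(ℝ, Model n) (𝓡 n) (extChartAt (𝓡 n) c).symm y
    (EuclideanSpace.single i 1 : Model n)

/-- The components `Xⁱ` of a vector field: the coordinates of `dφ(X)`. -/
def vecCoord (c : M) (X : VField n M) (y : Model n) (i : Fin n) : ℝ :=
  mvfderiv (𝓡 n) (extChartAt (𝓡 n) c) ((extChartAt (𝓡 n) c).symm y)
    (X ((extChartAt (𝓡 n) c).symm y)) i

/-- The components `∂ᵢ h` of `dh`. -/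
def diffCoord (c : M) (h : M → ℝ) (y : Model n) (i : Fin n) : ℝ :=
  pd i (fun z ↦ h ((extChartAt (𝓡 n) c).symm z)) y

/-- The coordinates of `p` in the preferred chart at `p`. -/
def base (p : M) : Model n := extChartAt (𝓡 n) p p

/-- The components of `X` at `p`, in the preferred chart at `p`. -/
def vecAt (X : VField n M) (p : M) : Fin n → ℝ := vecCoord p X (base p)

/-- The components of `dh` at `p`, in the preferred chart at `p`. -/
def diffAt (h : M → ℝ) (p : M) : Fin n → ℝ := diffCoord p h (base p)

end

section

variable {n : ℕ} {M : Type*} [TopologicalSpace M] [ChartedSpace (Model n) M]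
  [IsManifold (𝓡 n) ∞ M] (g : Metric n M)

/-- The components `g_{ij} = g(∂ᵢ, ∂ⱼ)` of the metric. -/
def metricCoord (c : M) (y : Model n) : Matrix (Fin n) (Fin n) ℝ :=
  Matrix.of fun i j ↦ g.inner ((extChartAt (𝓡 n) c).symm y) (coordVec c y i) (coordVec c y j)

/-- The Christoffel symbols `Γᵏ_{ij} = ½ gᵏˡ (∂ᵢ g_{jl} + ∂ⱼ g_{il} - ∂ₗ g_{ij})` of the
Levi-Civita connection. -/
def christoffel (c : M) (k i j : Fin n) (y : Model n) : ℝ :=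
  (1 / 2) * ∑ l, (metricCoord g c y)⁻¹ k l *
    (pd i (fun z ↦ metricCoord g c z j l) y + pd j (fun z ↦ metricCoord g c z i l) y
      - pd l (fun z ↦ metricCoord g c z i j) y)

/-- The components `∇ᵢ Xᵏ = ∂ᵢ Xᵏ + Γᵏ_{ij} Xʲ` of the covariant derivative of a vector field. -/
def covCoord (c : M) (X : VField n M) (y : Model n) (i k : Fin n) : ℝ :=
  pd i (fun z ↦ vecCoord c X z k) y + ∑ j, christoffel g c k i j y * vecCoord c X y j

/-- The Hessian `(∇²h)_{ij} = ∂ᵢ∂ⱼ h - Γᵏ_{ij} ∂ₖ h`. -/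
def hessCoord (c : M) (h : M → ℝ) (y : Model n) : Matrix (Fin n) (Fin n) ℝ :=
  Matrix.of fun i j ↦
    pd i (fun z ↦ diffCoord c h z j) y - ∑ k, christoffel g c k i j y * diffCoord c h y k

/-- The Lie derivative `(𝓛_X g)_{ij} = Xᵏ ∂ₖ g_{ij} + g_{kj} ∂ᵢ Xᵏ + g_{ik} ∂ⱼ Xᵏ`. -/
def lieCoord (c : M) (X : VField n M) (y : Model n) : Matrix (Fin n) (Fin n) ℝ :=
  Matrix.of fun i j ↦
    ∑ k, (vecCoord c X y k * pd k (fun z ↦ metricCoord g c z i j) y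
      + metricCoord g c y k j * pd i (fun z ↦ vecCoord c X z k) y
      + metricCoord g c y i k * pd j (fun z ↦ vecCoord c X z k) y)

/-- The Ricci tensor
`R_{jk} = ∂ᵢ Γⁱ_{jk} - ∂ⱼ Γⁱ_{ik} + Γⁱ_{il} Γˡ_{jk} - Γⁱ_{jl} Γˡ_{ik}`
(positive on round spheres). -/
def ricciCoord (c : M) (y : Model n) : Matrix (Fin n) (Fin n) ℝ :=
  Matrix.of fun j k ↦
    ∑ i, (pd i (christoffel g c i j k) y - pd j (christoffel g c i i k) y
      + ∑ l, (christoffel g c i i l y * christoffel g c l j k y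
        - christoffel g c i j l y * christoffel g c l i k y))

/-! ### Tensors at a point

Tensors at `p` are given by their components in the preferred chart at `p`. -/

/-- The metric at `p`. -/
def metricAt (p : M) : Matrix (Fin n) (Fin n) ℝ := metricCoord g p (base p)

/-- The Hessian `∇²h` at `p`. -/
def hess (h : M → ℝ) (p : M) : Matrix (Fin n) (Fin n) ℝ := hessCoord g p h (base p)

/-- The Lie derivative `𝓛_X g` at `p`. -/
def lieMetric (X : VField n M) (p : M) : Matrix (Fin n) (Fin n) ℝ := lieCoord g p X (base p)

/-- The Ricci tensor at `p`. -/
def ricci (p : M) : Matrix (Fin n) (Fin n) ℝ := ricciCoord g p (base p)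

/-- The value `Ric(X, Y)` at `p`. -/
def ricciApply (X Y : VField n M) (p : M) : ℝ :=
  ∑ i, ∑ j, ricci g p i j * vecAt X p i * vecAt Y p j

/-- The components `Xᵢ = g_{ij} Xʲ` of the one-form `X♭` at `p`. -/
def flat (X : VField n M) (p : M) : Fin n → ℝ := metricAt g p *ᵥ vecAt X p

/-- The divergence `div X = tr ∇X = ∇ᵢ Xⁱ`. -/
def divergence (X : VField n M) (p : M) : ℝ := ∑ i, covCoord g p X (base p) i i

/-- The inner product `g(A, B) = gⁱᵏ gʲˡ A_{ij} B_{kl}` of two covariant 2-tensors at `p`. -/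
def tensorInner (p : M) (A B : Matrix (Fin n) (Fin n) ℝ) : ℝ :=
  ∑ i, ∑ j, ∑ k, ∑ l, (metricAt g p)⁻¹ i k * (metricAt g p)⁻¹ j l * A i j * B k l

/-- The squared norm `|X|² = g(X, X)`. -/
def normSq (X : VField n M) (p : M) : ℝ := g.inner p (X p) (X p)

/-- The scalar curvature `R = gⁱʲ R_{ij}`. -/
def scalar (p : M) : ℝ := ∑ i, ∑ j, (metricAt g p)⁻¹ i j * ricci g p i j

/-- The Schouten tensor `A = (Ric - R / (2 (n - 1)) g) / (n - 2)`, for `n ≥ 3`. -/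
def schouten (p : M) : Matrix (Fin n) (Fin n) ℝ :=
  (1 / ((n : ℝ) - 2)) • (ricci g p - (scalar g p / (2 * ((n : ℝ) - 1))) • metricAt g p)

/-- The `σ_k`-curvature: the `k`-th elementary symmetric function of the eigenvalues, with
multiplicity, of `g⁻¹ A` (they are real, as `g⁻¹ A` is self-adjoint with respect to `g`). -/
def sigma (k : ℕ) (p : M) : ℝ :=
  ((metricAt g p)⁻¹ * schouten g p).charpoly.roots.esymm k

/-! ### Gradient -/

/-- The metric at `p` as a bilinear form on the tangent space. -/
def metricForm (p : M) : LinearMap.BilinForm ℝ (TangentSpace (𝓡 n) p) :=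
  LinearMap.mk₂ ℝ (fun v w ↦ g.inner p v w) (by simp) (by simp) (by simp) (by simp)

theorem metricForm_nondegenerate (p : M) : (metricForm g p).Nondegenerate := by
  constructor
  · intro v hv
    by_contra h
    exact (g.pos p v h).ne' (hv v)
  · intro v hv
    by_contra h
    exact (g.pos p v h).ne' (hv v)

/-- The gradient of `h`: `g(∇h, w) = dh(w)` for every tangent vector `w`. -/
def grad (h : M → ℝ) : VField n M := fun p ↦
  ((metricForm g p).toDual (metricForm_nondegenerate g p)).symm
    (mvfderiv (𝓡 n) h p : TangentSpace (𝓡 n) p →ₗ[ℝ] ℝ)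

/-- `X` is a gradient field: `X = ∇f` for a smooth function `f`. -/
def IsGradientField (X : VField n M) : Prop :=
  ∃ f : M → ℝ, ContMDiff (𝓡 n) 𝓘(ℝ, ℝ) ∞ f ∧ ∀ p, X p = grad g f p

/-! ### Riemannian volume -/

/-- The measure `√(det g_{ij}) dy¹ ⋯ dyⁿ` of the chart at `c`, carried to the domain of that chart
and extended by zero to `M`. -/
def chartVolume [MeasurableSpace M] (c : M) : Measure M :=
  ((volume.restrict (extChartAt (𝓡 n) c).target).withDensity
    (fun y ↦ ENNReal.ofReal √(metricCoord g c y).det)).map (extChartAt (𝓡 n) c).symm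

/-- The Riemannian volume measure `dv_g`. The measures of two charts agree on the overlap of their
domains; the measure on `M` glued from them is their least upper bound. -/
def riemannianVolume [MeasurableSpace M] : Measure M := ⨆ c : M, chartVolume g c

/-! ### Solitons -/

/-- `(M, g, X, lam)` is a quasi `k`-Yamabe soliton with constant `m ≠ 0`:
`X` is smooth and `½ 𝓛_X g - (1/m) X♭ ⊗ X♭ = (σ_k - lam) g`. -/
structure IsQuasiYamabeSoliton (k : ℕ) (m lam : ℝ) (X : VField n M) : Prop where
  m_ne_zero : m ≠ 0
  smooth : IsSmoothField X
  equation : ∀ p, (1 / 2 : ℝ) • lieMetric g X p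
      - (1 / m) • Matrix.vecMulVec (flat g X p) (flat g X p)
    = (sigma g k p - lam) • metricAt g p

/-- `X = ∇h + Y` with `h` and `Y` smooth and `div Y = 0`: the Hodge-de Rham decomposition of `X`. -/
structure IsHodgeDecomposition (X : VField n M) (h : M → ℝ) (Y : VField n M) : Prop where
  smooth_potential : ContMDiff (𝓡 n) 𝓘(ℝ, ℝ) ∞ h
  smooth_field : IsSmoothField Y
  decomposition : ∀ p, X p = grad g h p + Y p
  divergence_free : ∀ p, divergence g Y p = 0

end

end QuasiYamabe

end

open QuasiYamabe

/-!
Write `s = σ_k - λ` and `T = ∇²h - (1/m) dh ⊗ dh - s g`. Tracing the soliton equation gives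
`div X = |X|²/m + n s`, and with the Bochner identity for `div (∇_{∇h} Y)` this turns the integrand
into `|T|² + div (∇_{∇h} Y) + (1/2m) div (|X|² X)`, so that its integral is `∫ |T|² ≥ 0`.

If the integral is nonpositive then `T = 0`. As `div ∇h = div X`, the trace of `T` is
`(|X|² - |∇h|²)/m`, hence `|X|² = |∇h|²`, that is `|Y|² = -2 g(∇h, Y)`. The right-hand side
integrates to zero because `div Y = 0`, so `Y = 0`.

Conversely, if `X = ∇f` then `Y = ∇(f - h)` is `L²`-orthogonal to itself, so `Y = 0`, `X = ∇h`, and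
`T = 0` by the soliton equation.
-/

noncomputable section

namespace QuasiYamabe

open Set Filter Topology

section Calculus

variable {n : ℕ} {y : Model n}

theorem eq_sum_single (u : Model n) : u = ∑ i, u i • (EuclideanSpace.single i 1 : Model n) := by
  ext j
  simp [Pi.single_apply]

theorem fderiv_eq_sum_pd (f : Model n → ℝ) (y u : Model n) :
    fderiv ℝ f y u = ∑ i, u i * pd i f y := by
  conv_lhs => rw [eq_sum_single u]
  simp [pd]

theorem fderiv_coord {f : Model n → Model n} (hf : DifferentiableAt ℝ f y)
    (u : Model n) (k : Fin n) : fderiv ℝ (fun z ↦ f z k) y u = fderiv ℝ f y u k :=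
  congrArg (fun L ↦ L u)
    ((EuclideanSpace.proj k : Model n →L[ℝ] ℝ).hasFDerivAt.comp y hf.hasFDerivAt).fderiv

theorem fderiv_fderiv_comm {E F : Type*} [NormedAddCommGroup E] [NormedSpace ℝ E]
    [NormedAddCommGroup F] [NormedSpace ℝ F] {f : E → F} {x : E} (hf : ContDiffAt ℝ ∞ f x)
    (u v : E) : fderiv ℝ (fderiv ℝ f) x u v = fderiv ℝ (fderiv ℝ f) x v u :=
  (hf.isSymmSndFDerivAt (by
    rw [minSmoothness_of_isRCLikeNormedField]
    exact WithTop.coe_le_coe.2 (le_top : (2 : ℕ∞) ≤ ⊤))).eq u v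

theorem hasFDerivAt_fderiv {E F : Type*} [NormedAddCommGroup E] [NormedSpace ℝ E]
    [NormedAddCommGroup F] [NormedSpace ℝ F] {f : E → F} {x : E} (hf : ContDiffAt ℝ ∞ f x) :
    HasFDerivAt (fderiv ℝ f) (fderiv ℝ (fderiv ℝ f) x) x :=
  ((hf.fderiv_right (m := ∞) (by simp)).differentiableAt (by simp)).hasFDerivAt

theorem pd_pd {f : Model n → ℝ} (hf : ContDiffAt ℝ ∞ f y) (i j : Fin n) :
    pd i (pd j f) y =
      fderiv ℝ (fderiv ℝ f) y (EuclideanSpace.single i 1) (EuclideanSpace.single j 1) := by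
  change fderiv ℝ (fun z ↦ fderiv ℝ f z (EuclideanSpace.single j 1)) y _ = _
  rw [((hasFDerivAt_fderiv hf).clm_apply (hasFDerivAt_const _ y)).fderiv]
  simp

theorem pd_comm {f : Model n → ℝ} (hf : ContDiffAt ℝ ∞ f y) (i j : Fin n) :
    pd i (pd j f) y = pd j (pd i f) y := by
  rw [pd_pd hf, pd_pd hf, fderiv_fderiv_comm hf]

theorem pd_congr {f f' : Model n → ℝ} (h : f =ᶠ[𝓝 y] f') (i : Fin n) :
    pd i f y = pd i f' y := by
  rw [pd, pd, h.fderiv_eq]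

theorem pd_add {f f' : Model n → ℝ} (hf : DifferentiableAt ℝ f y)
    (hf' : DifferentiableAt ℝ f' y) (i : Fin n) :
    pd i (fun z ↦ f z + f' z) y = pd i f y + pd i f' y := by
  simp [pd, fderiv_fun_add hf hf']

theorem pd_mul {f f' : Model n → ℝ} (hf : DifferentiableAt ℝ f y)
    (hf' : DifferentiableAt ℝ f' y) (i : Fin n) :
    pd i (fun z ↦ f z * f' z) y = pd i f y * f' y + f y * pd i f' y := by
  simp [pd, fderiv_fun_mul hf hf']
  ring

theorem pd_sum {ι : Type*} {s : Finset ι} {f : ι → Model n → ℝ}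
    (hf : ∀ a ∈ s, DifferentiableAt ℝ (f a) y) (i : Fin n) :
    pd i (fun z ↦ ∑ a ∈ s, f a z) y = ∑ a ∈ s, pd i (f a) y := by
  simp [pd, fderiv_fun_sum hf, sum_apply]

theorem contDiffOn_pd {f : Model n → ℝ} {s : Set (Model n)} (hs : IsOpen s)
    (hf : ContDiffOn ℝ ∞ f s) (i : Fin n) : ContDiffOn ℝ ∞ (pd i f) s :=
  (hf.fderiv_of_isOpen hs (m := ∞) (by simp)).clm_apply contDiffOn_const

theorem contDiffOn_det {E ι : Type*} [NormedAddCommGroup E] [NormedSpace ℝ E] [Fintype ι]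
    [DecidableEq ι] {A : E → Matrix ι ι ℝ} {s : Set E}
    (hA : ∀ i j, ContDiffOn ℝ ∞ (fun x ↦ A x i j) s) : ContDiffOn ℝ ∞ (fun x ↦ (A x).det) s := by
  simp only [Matrix.det_apply']
  exact ContDiffOn.sum fun σ _ ↦ contDiffOn_const.mul (contDiffOn_prod fun i _ ↦ hA _ _)

theorem contDiffOn_matrix_inv {E ι : Type*} [NormedAddCommGroup E] [NormedSpace ℝ E] [Fintype ι]
    [DecidableEq ι] {A : E → Matrix ι ι ℝ} {s : Set E}
    (hA : ∀ i j, ContDiffOn ℝ ∞ (fun x ↦ A x i j) s) (hdet : ∀ x ∈ s, (A x).det ≠ 0) (i j : ι) :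
    ContDiffOn ℝ ∞ (fun x ↦ (A x)⁻¹ i j) s := by
  simp only [Matrix.inv_def, Ring.inverse_eq_inv', Matrix.smul_apply, Matrix.adjugate_apply,
    smul_eq_mul]
  refine ((contDiffOn_det hA).inv hdet).mul (contDiffOn_det fun k l ↦ ?_)
  simp only [Matrix.updateRow_apply]
  split_ifs
  exacts [contDiffOn_const, hA k l]

end Calculus

section Charts

variable {n : ℕ} {M : Type*} [TopologicalSpace M] [ChartedSpace (Model n) M]

/-- The vector field `X` read in the chart at `c`, as a function with values in `ℝⁿ`; its
components are the `vecCoord c X y i`. -/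
def fieldRep (c : M) (X : VField n M) (y : Model n) : Model n :=
  mvfderiv (𝓡 n) (extChartAt (𝓡 n) c) ((extChartAt (𝓡 n) c).symm y)
    (X ((extChartAt (𝓡 n) c).symm y))

/-- The function `f` read in the chart at `c`. -/
def funRep (c : M) (f : M → ℝ) (y : Model n) : ℝ := f ((extChartAt (𝓡 n) c).symm y)

/-- Smoothness of a vector field, as smoothness of its expression in each chart. -/
def SmoothInCharts (X : VField n M) : Prop :=
  ∀ c, ContDiffOn ℝ ∞ (fieldRep c X) (extChartAt (𝓡 n) c).target

/-- Smoothness of a function, as smoothness of its expression in each chart. -/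
def SmoothFunInCharts (f : M → ℝ) : Prop :=
  ∀ c, ContDiffOn ℝ ∞ (funRep c f) (extChartAt (𝓡 n) c).target

theorem isOpen_chartTarget (c : M) : IsOpen (extChartAt (𝓡 n) c).target :=
  isOpen_extChartAt_target c

theorem base_mem_target (p : M) : (base p : Model n) ∈ (extChartAt (𝓡 n) p).target :=
  mem_extChartAt_target p

@[simp] theorem chart_symm_base (p : M) : (extChartAt (𝓡 n) p).symm (base p) = p :=
  extChartAt_to_inv p

theorem exists_chart_symm_eq {c p : M} (hp : p ∈ (extChartAt (𝓡 n) c).source) :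
    ∃ y ∈ (extChartAt (𝓡 n) c).target, (extChartAt (𝓡 n) c).symm y = p :=
  ⟨_, (extChartAt (𝓡 n) c).map_source hp, (extChartAt (𝓡 n) c).left_inv hp⟩

theorem contDiffAt_of_contDiffOn_target {F : Type*} [NormedAddCommGroup F] [NormedSpace ℝ F]
    {c : M} {f : Model n → F} (hf : ContDiffOn ℝ ∞ f (extChartAt (𝓡 n) c).target)
    {y : Model n} (hy : y ∈ (extChartAt (𝓡 n) c).target) : ContDiffAt ℝ ∞ f y :=
  hf.contDiffAt ((isOpen_chartTarget c).mem_nhds hy)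

theorem differentiableAt_of_contDiffOn_target {F : Type*} [NormedAddCommGroup F]
    [NormedSpace ℝ F] {c : M} {f : Model n → F}
    (hf : ContDiffOn ℝ ∞ f (extChartAt (𝓡 n) c).target)
    {y : Model n} (hy : y ∈ (extChartAt (𝓡 n) c).target) : DifferentiableAt ℝ f y :=
  (contDiffAt_of_contDiffOn_target hf hy).differentiableAt (by simp)

theorem continuous_of_chart {f : M → ℝ} (F : M → Model n → ℝ)
    (hF : ∀ c, ContinuousOn (F c) (extChartAt (𝓡 n) c).target)
    (h : ∀ c, ∀ p ∈ (extChartAt (𝓡 n) c).source, f p = F c (extChartAt (𝓡 n) c p)) :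
    Continuous f := by
  refine continuous_iff_continuousAt.2 fun c ↦ ?_
  have hFc : ContinuousAt (F c) (extChartAt (𝓡 n) c c) :=
    (hF c).continuousAt ((isOpen_chartTarget c).mem_nhds (mem_extChartAt_target c))
  refine (hFc.comp (continuousAt_extChartAt c)).congr ?_
  filter_upwards [extChartAt_source_mem_nhds (I := 𝓡 n) c] with p hp
  exact (h c p hp).symm

theorem fieldRep_chart {c p : M} (hp : p ∈ (extChartAt (𝓡 n) c).source) (X : VField n M) :
    fieldRep c X (extChartAt (𝓡 n) c p) = mvfderiv (𝓡 n) (extChartAt (𝓡 n) c) p (X p) := by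
  obtain ⟨y, hy, rfl⟩ := exists_chart_symm_eq hp
  rw [(extChartAt (𝓡 n) c).right_inv hy]
  rfl

theorem fieldRep_smul (c : M) (f : M → ℝ) (X : VField n M) (y : Model n) :
    fieldRep c (fun p ↦ f p • X p) y = funRep c f y • fieldRep c X y :=
  map_smul (mvfderiv (𝓡 n) (extChartAt (𝓡 n) c) _) _ _

theorem fieldRep_sum {ι : Type*} (s : Finset ι) (c : M) (X : ι → VField n M) (y : Model n) :
    fieldRep c (fun p ↦ ∑ i ∈ s, X i p) y = ∑ i ∈ s, fieldRep c (X i) y :=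
  map_sum (mvfderiv (𝓡 n) (extChartAt (𝓡 n) c) _) _ _

theorem funRep_chart {c p : M} (hp : p ∈ (extChartAt (𝓡 n) c).source) (f : M → ℝ) :
    funRep c f (extChartAt (𝓡 n) c p) = f p := by
  rw [funRep, (extChartAt (𝓡 n) c).left_inv hp]

theorem SmoothFunInCharts.continuous {f : M → ℝ} (hf : SmoothFunInCharts (n := n) f) :
    Continuous f :=
  continuous_of_chart (fun c ↦ funRep c f) (fun c ↦ (hf c).continuousOn)
    fun _ _ hp ↦ (funRep_chart hp f).symm

theorem SmoothInCharts.smul {f : M → ℝ} (hf : SmoothFunInCharts (n := n) f) {X : VField n M}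
    (hX : SmoothInCharts X) : SmoothInCharts (fun p ↦ f p • X p) :=
  fun c ↦ ((hf c).smul (hX c)).congr fun y _ ↦ fieldRep_smul c f X y

theorem SmoothInCharts.coord {X : VField n M} (hX : SmoothInCharts X) (c : M) (k : Fin n) :
    ContDiffOn ℝ ∞ (fun y ↦ vecCoord c X y k) (extChartAt (𝓡 n) c).target :=
  (EuclideanSpace.proj k : Model n →L[ℝ] ℝ).contDiff.comp_contDiffOn (hX c)

theorem SmoothInCharts.differentiableAt {X : VField n M} (hX : SmoothInCharts X) {c : M}
    {y : Model n} (hy : y ∈ (extChartAt (𝓡 n) c).target) :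
    DifferentiableAt ℝ (fieldRep c X) y :=
  differentiableAt_of_contDiffOn_target (hX c) hy

theorem pd_vecCoord {X : VField n M} (hX : SmoothInCharts X) {c : M} {y : Model n}
    (hy : y ∈ (extChartAt (𝓡 n) c).target) (i k : Fin n) :
    pd i (fun z ↦ vecCoord c X z k) y =
      fderiv ℝ (fieldRep c X) y (EuclideanSpace.single i 1) k :=
  fderiv_coord (hX.differentiableAt hy) _ k

theorem mfderiv_chart_symm_eq_sum (c : M) (y w : Model n) :
    mfderiv 𝓘(ℝ, Model n) (𝓡 n) (extChartAt (𝓡 n) c).symm y w = ∑ i, w i • coordVec c y i := by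
  conv_lhs => rw [eq_sum_single w]
  exact (map_sum (mfderiv 𝓘(ℝ, Model n) (𝓡 n) (extChartAt (𝓡 n) c).symm y) _ _).trans
    (Finset.sum_congr rfl fun i _ ↦
      map_smul (mfderiv 𝓘(ℝ, Model n) (𝓡 n) (extChartAt (𝓡 n) c).symm y) _ _)

variable [IsManifold (𝓡 n) ∞ M]

theorem mfderiv_symm_comp {c : M} {y : Model n} (hy : y ∈ (extChartAt (𝓡 n) c).target)
    (v : TangentSpace (𝓡 n) ((extChartAt (𝓡 n) c).symm y)) :
    mfderiv 𝓘(ℝ, Model n) (𝓡 n) (extChartAt (𝓡 n) c).symm y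
      (mvfderiv (𝓡 n) (extChartAt (𝓡 n) c) ((extChartAt (𝓡 n) c).symm y) v) = v := by
  have h := mfderivWithin_extChartAt_symm_comp_mfderiv_extChartAt (I := 𝓡 n) hy
  rw [ModelWithCorners.range_eq_univ, mfderivWithin_univ] at h
  exact congrArg (fun L ↦ L v) h

theorem mvfderiv_comp_symm {c : M} {y : Model n} (hy : y ∈ (extChartAt (𝓡 n) c).target)
    (v : Model n) :
    mvfderiv (𝓡 n) (extChartAt (𝓡 n) c) ((extChartAt (𝓡 n) c).symm y)
      (mfderiv 𝓘(ℝ, Model n) (𝓡 n) (extChartAt (𝓡 n) c).symm y v) = v := by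
  have h := mfderiv_extChartAt_comp_mfderivWithin_extChartAt_symm (I := 𝓡 n) hy
  rw [ModelWithCorners.range_eq_univ, mfderivWithin_univ] at h
  exact congrArg (fun L ↦ L v) h

theorem mvfderiv_chart_injective {c p : M} (hp : p ∈ (extChartAt (𝓡 n) c).source) :
    Function.Injective (mvfderiv (𝓡 n) (extChartAt (𝓡 n) c) p) := by
  obtain ⟨y, hy, rfl⟩ := exists_chart_symm_eq hp
  exact Function.LeftInverse.injective (mfderiv_symm_comp hy)

theorem mvfderiv_chart_surjective {c p : M} (hp : p ∈ (extChartAt (𝓡 n) c).source) :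
    Function.Surjective (mvfderiv (𝓡 n) (extChartAt (𝓡 n) c) p) := by
  obtain ⟨y, hy, rfl⟩ := exists_chart_symm_eq hp
  exact Function.RightInverse.surjective (mvfderiv_comp_symm hy)

theorem contMDiffOn_chart_symm (c : M) :
    ContMDiffOn 𝓘(ℝ, Model n) (𝓡 n) ∞ (extChartAt (𝓡 n) c).symm (extChartAt (𝓡 n) c).target :=
  contMDiffOn_extChartAt_symm c

theorem mdifferentiableAt_chart_symm {c : M} {y : Model n}
    (hy : y ∈ (extChartAt (𝓡 n) c).target) :
    MDifferentiableAt 𝓘(ℝ, Model n) (𝓡 n) (extChartAt (𝓡 n) c).symm y :=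
  ((contMDiffOn_chart_symm c).contMDiffAt ((isOpen_chartTarget c).mem_nhds hy)).mdifferentiableAt
    (by simp)

theorem mdifferentiableAt_chart {c p : M} (hp : p ∈ (extChartAt (𝓡 n) c).source) :
    MDifferentiableAt (𝓡 n) 𝓘(ℝ, Model n) (extChartAt (𝓡 n) c) p :=
  mdifferentiableAt_extChartAt (by simpa using hp)

theorem mvfderiv_eq_fderiv_comp_symm {F : Type*} [NormedAddCommGroup F] [NormedSpace ℝ F]
    {f : M → F} {c : M} {y : Model n} (hy : y ∈ (extChartAt (𝓡 n) c).target)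
    (hf : MDifferentiableAt (𝓡 n) 𝓘(ℝ, F) f ((extChartAt (𝓡 n) c).symm y))
    (v : TangentSpace (𝓡 n) ((extChartAt (𝓡 n) c).symm y)) :
    mvfderiv (𝓡 n) f ((extChartAt (𝓡 n) c).symm y) v =
      fderiv ℝ (fun z ↦ f ((extChartAt (𝓡 n) c).symm z)) y
        (mvfderiv (𝓡 n) (extChartAt (𝓡 n) c) ((extChartAt (𝓡 n) c).symm y) v) := by
  have hcomp := congrArg
    (fun L ↦ L (mvfderiv (𝓡 n) (extChartAt (𝓡 n) c) ((extChartAt (𝓡 n) c).symm y) v))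
    (mfderiv_eq_fderiv.symm.trans (mfderiv_comp y hf (mdifferentiableAt_chart_symm hy)))
  refine Eq.trans ?_ hcomp.symm
  exact congrArg (mvfderiv (𝓡 n) f ((extChartAt (𝓡 n) c).symm y)) (mfderiv_symm_comp hy v).symm

theorem trivializationAt_eq_mvfderiv {c p : M}
    (hp : p ∈ (extChartAt (𝓡 n) c).source) (v : TangentSpace (𝓡 n) p) :
    (trivializationAt (Model n) (TangentSpace (𝓡 n)) c ⟨p, v⟩).2 =
      mvfderiv (𝓡 n) (extChartAt (𝓡 n) c) p v := by
  have hchart : p ∈ (chartAt (Model n) c).source := by simpa using hp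
  have hbase : p ∈ (trivializationAt (Model n) (TangentSpace (𝓡 n)) c).baseSet := hchart
  refine Eq.trans ?_ (congrArg (fun L ↦ L v)
    (TangentBundle.continuousLinearMapAt_trivializationAt (I := 𝓡 n) hchart))
  rw [Trivialization.continuousLinearMapAt_apply, Trivialization.coe_linearMapAt_of_mem _ hbase]

theorem IsSmoothField.smoothInCharts {X : VField n M} (hX : IsSmoothField X) :
    SmoothInCharts X := by
  intro c
  rw [← contMDiffOn_iff_contDiffOn]
  have hsection := (Trivialization.contMDiffOn_section_baseSet_iff (n := ∞) (s := X) (IB := 𝓡 n)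
    (trivializationAt (Model n) (TangentSpace (𝓡 n)) c)).1 (ContMDiff.contMDiffOn hX)
  have hsource : ContMDiffOn (𝓡 n) 𝓘(ℝ, Model n) ∞
      (fun x ↦ mvfderiv (𝓡 n) (extChartAt (𝓡 n) c) x (X x)) (extChartAt (𝓡 n) c).source :=
    (hsection.mono fun x hx ↦ by simpa using hx).congr fun x hx ↦
      (trivializationAt_eq_mvfderiv hx (X x)).symm
  exact hsource.comp (contMDiffOn_chart_symm c) fun y hy ↦ (extChartAt (𝓡 n) c).map_target hy

theorem smoothFunInCharts_of_contMDiff {f : M → ℝ} (hf : ContMDiff (𝓡 n) 𝓘(ℝ, ℝ) ∞ f) :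
    SmoothFunInCharts (n := n) f := fun c ↦ by
  rw [← contMDiffOn_iff_contDiffOn]
  exact hf.comp_contMDiffOn (contMDiffOn_chart_symm c)

theorem contMDiffOn_coordVec (c : M) (i : Fin n) :
    ContMDiffOn 𝓘(ℝ, Model n) (𝓡 n).tangent ∞
      (fun y ↦ (⟨(extChartAt (𝓡 n) c).symm y, coordVec c y i⟩ : TangentBundle (𝓡 n) M))
      (extChartAt (𝓡 n) c).target := by
  refine (Trivialization.contMDiffOn_iff
    (e := trivializationAt (Model n) (TangentSpace (𝓡 n)) c) fun y hy ↦ ?_).2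
      ⟨contMDiffOn_chart_symm c, ?_⟩
  · rw [Trivialization.mem_source]
    simpa using (extChartAt (𝓡 n) c).map_target hy
  · refine (contMDiffOn_const (c := (EuclideanSpace.single i 1 : Model n))).congr fun y hy ↦ ?_
    exact (trivializationAt_eq_mvfderiv
      ((extChartAt (𝓡 n) c).map_target hy) (coordVec c y i)).trans
        (mvfderiv_comp_symm hy (EuclideanSpace.single i 1))

theorem contDiffOn_metricCoord (g : Metric n M) (c : M) (i j : Fin n) :
    ContDiffOn ℝ ∞ (fun y ↦ metricCoord g c y i j) (extChartAt (𝓡 n) c).target := by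
  rw [← contMDiffOn_iff_contDiffOn]
  let _ : RiemannianBundle (fun x : M ↦ TangentSpace (𝓡 n) x) := ⟨g.toRiemannianMetric⟩
  exact ContMDiffOn.inner_bundle (contMDiffOn_coordVec c i) (contMDiffOn_coordVec c j)

end Charts

section Transition

variable {n : ℕ} {M : Type*} [TopologicalSpace M] [ChartedSpace (Model n) M]

/-- The change of coordinates from the chart at `c` to the chart at `d`. -/
def transition (c d : M) (y : Model n) : Model n :=
  extChartAt (𝓡 n) d ((extChartAt (𝓡 n) c).symm y)

/-- The domain of the change of coordinates from the chart at `c` to the chart at `d`. -/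
def overlap (c d : M) : Set (Model n) :=
  (extChartAt (𝓡 n) c).target ∩ (extChartAt (𝓡 n) c).symm ⁻¹' (extChartAt (𝓡 n) d).source

theorem isOpen_overlap (c d : M) : IsOpen (overlap c d : Set (Model n)) :=
  (continuousOn_extChartAt_symm c).isOpen_inter_preimage (isOpen_chartTarget c)
    (isOpen_extChartAt_source d)

theorem chart_mem_overlap {c d p : M} (hc : p ∈ (extChartAt (𝓡 n) c).source)
    (hd : p ∈ (extChartAt (𝓡 n) d).source) :
    extChartAt (𝓡 n) c p ∈ (overlap c d : Set (Model n)) :=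
  ⟨(extChartAt (𝓡 n) c).map_source hc, by
    rwa [mem_preimage, (extChartAt (𝓡 n) c).left_inv hc]⟩

theorem chart_symm_transition {c d : M} {y : Model n} (hy : y ∈ overlap c d) :
    (extChartAt (𝓡 n) d).symm (transition c d y) = (extChartAt (𝓡 n) c).symm y :=
  (extChartAt (𝓡 n) d).left_inv hy.2

theorem transition_mem_target {c d : M} {y : Model n} (hy : y ∈ overlap c d) :
    transition c d y ∈ (extChartAt (𝓡 n) d).target :=
  (extChartAt (𝓡 n) d).map_source hy.2

theorem transition_transition {c d : M} {y : Model n} (hy : y ∈ overlap c d) :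
    transition d c (transition c d y) = y := by
  rw [transition, chart_symm_transition hy]
  exact (extChartAt (𝓡 n) c).right_inv hy.1

theorem transition_chart {c d p : M} (hc : p ∈ (extChartAt (𝓡 n) c).source) :
    transition c d (extChartAt (𝓡 n) c p) = extChartAt (𝓡 n) d p := by
  rw [transition, (extChartAt (𝓡 n) c).left_inv hc]

variable [IsManifold (𝓡 n) ∞ M]

theorem contDiffAt_transition {c d : M} {y : Model n} (hy : y ∈ overlap c d) :
    ContDiffAt ℝ ∞ (transition c d) y := by
  refine ((contDiffOn_ext_coord_change (I := 𝓡 n) (n := ∞) d c).mono fun z hz ↦ ?_).contDiffAt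
    ((isOpen_overlap c d).mem_nhds hy)
  simpa [PartialEquiv.trans_source, overlap] using hz

theorem hasFDerivAt_transition {c d : M} {y : Model n} (hy : y ∈ overlap c d) :
    HasFDerivAt (transition c d) (fderiv ℝ (transition c d) y) y :=
  ((contDiffAt_transition hy).differentiableAt (by simp)).hasFDerivAt

theorem mvfderiv_chart_eq_fderiv_transition {c d : M} {y : Model n} (hy : y ∈ overlap c d)
    (v : TangentSpace (𝓡 n) ((extChartAt (𝓡 n) c).symm y)) :
    mvfderiv (𝓡 n) (extChartAt (𝓡 n) d) ((extChartAt (𝓡 n) c).symm y) v =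
      fderiv ℝ (transition c d) y
        (mvfderiv (𝓡 n) (extChartAt (𝓡 n) c) ((extChartAt (𝓡 n) c).symm y) v) :=
  mvfderiv_eq_fderiv_comp_symm hy.1 (mdifferentiableAt_chart hy.2) v

theorem fieldRep_transition {c d : M} {y : Model n} (hy : y ∈ overlap c d) (X : VField n M) :
    fieldRep d X (transition c d y) = fderiv ℝ (transition c d) y (fieldRep c X y) := by
  rw [transition, fieldRep_chart hy.2, mvfderiv_chart_eq_fderiv_transition hy]
  rfl

theorem fderiv_fieldRep_transition {c d : M} {y : Model n} (hy : y ∈ overlap c d)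
    {X : VField n M} (hX : SmoothInCharts X) (u : Model n) :
    fderiv ℝ (fieldRep d X) (transition c d y) (fderiv ℝ (transition c d) y u) =
      fderiv ℝ (fderiv ℝ (transition c d)) y u (fieldRep c X y)
        + fderiv ℝ (transition c d) y (fderiv ℝ (fieldRep c X) y u) := by
  have hrep : (fun z ↦ fieldRep d X (transition c d z)) =ᶠ[𝓝 y] fun z ↦
      fderiv ℝ (transition c d) z (fieldRep c X z) := by
    filter_upwards [(isOpen_overlap c d).mem_nhds hy] with z hz
    exact fieldRep_transition hz X
  have hleft := (hX.differentiableAt (transition_mem_target hy)).hasFDerivAt.comp y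
    (hasFDerivAt_transition hy)
  have hright := (hasFDerivAt_fderiv (contDiffAt_transition hy)).clm_apply
    (hX.differentiableAt hy.1).hasFDerivAt
  simpa [add_comm] using congrArg (fun L ↦ L u) (hleft.unique (hright.congr_of_eventuallyEq hrep))

theorem fderiv_transition_bijective {c d : M} {y : Model n} (hy : y ∈ overlap c d) :
    Function.Bijective (fderiv ℝ (transition c d) y) := by
  have hsurj := mvfderiv_chart_surjective ((extChartAt (𝓡 n) c).map_target hy.1)
  constructor
  · intro u v huv
    obtain ⟨u, rfl⟩ := hsurj u
    obtain ⟨v, rfl⟩ := hsurj v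
    rw [← mvfderiv_chart_eq_fderiv_transition hy, ← mvfderiv_chart_eq_fderiv_transition hy] at huv
    rw [mvfderiv_chart_injective hy.2 huv]
  · intro w
    obtain ⟨v, rfl⟩ := mvfderiv_chart_surjective hy.2 w
    exact ⟨_, (mvfderiv_chart_eq_fderiv_transition hy v).symm⟩

end Transition

section MetricForm

variable {n : ℕ} {M : Type*} [TopologicalSpace M] [ChartedSpace (Model n) M]
  [IsManifold (𝓡 n) ∞ M] (g : Metric n M)

-- Typeclass search times out on these two structures when it is left to unfold them itself.
instance instNormedAddCommGroupBilin :
    NormedAddCommGroup (Model n →L[ℝ] Model n →L[ℝ] ℝ) :=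
  ContinuousLinearMap.toNormedAddCommGroup

instance instNormedSpaceBilin : NormedSpace ℝ (Model n →L[ℝ] Model n →L[ℝ] ℝ) :=
  ContinuousLinearMap.toNormedSpace

/-- The metric read in the chart at `c`, as a bilinear form on `ℝⁿ`. -/
def metricBil (c : M) (y : Model n) : Model n →L[ℝ] Model n →L[ℝ] ℝ :=
  ∑ i, ∑ j, metricCoord g c y i j •
    (EuclideanSpace.proj i : Model n →L[ℝ] ℝ).smulRight (EuclideanSpace.proj j : Model n →L[ℝ] ℝ)

theorem metricBil_apply (c : M) (y u v : Model n) :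
    metricBil g c y u v = ∑ i, ∑ j, metricCoord g c y i j * u i * v j := by
  simp [metricBil, mul_assoc]

theorem metricBil_single (c : M) (y : Model n) (i j : Fin n) :
    metricBil g c y (EuclideanSpace.single i 1) (EuclideanSpace.single j 1)
      = metricCoord g c y i j := by
  simp [metricBil_apply]

theorem metricBil_eq_inner (c : M) (y u v : Model n) :
    metricBil g c y u v = g.inner ((extChartAt (𝓡 n) c).symm y)
      (mfderiv 𝓘(ℝ, Model n) (𝓡 n) (extChartAt (𝓡 n) c).symm y u)
      (mfderiv 𝓘(ℝ, Model n) (𝓡 n) (extChartAt (𝓡 n) c).symm y v) := by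
  rw [metricBil_apply, mfderiv_chart_symm_eq_sum, mfderiv_chart_symm_eq_sum]
  simp only [map_sum, map_smul, sum_apply, smul_apply,
    smul_eq_mul, metricCoord, Matrix.of_apply]
  rw [Finset.sum_comm]
  refine Finset.sum_congr rfl fun i _ ↦ ?_
  rw [Finset.mul_sum]
  exact Finset.sum_congr rfl fun j _ ↦ by ring

theorem metricBil_chart {c p : M} (hp : p ∈ (extChartAt (𝓡 n) c).source)
    (v w : TangentSpace (𝓡 n) p) :
    metricBil g c (extChartAt (𝓡 n) c p) (mvfderiv (𝓡 n) (extChartAt (𝓡 n) c) p v)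
      (mvfderiv (𝓡 n) (extChartAt (𝓡 n) c) p w) = g.inner p v w := by
  obtain ⟨y, hy, rfl⟩ := exists_chart_symm_eq hp
  rw [(extChartAt (𝓡 n) c).right_inv hy, metricBil_eq_inner, mfderiv_symm_comp hy,
    mfderiv_symm_comp hy]

theorem metricBil_transition {c d : M} {y : Model n} (hy : y ∈ overlap c d) (u v : Model n) :
    metricBil g c y u v = metricBil g d (transition c d y) (fderiv ℝ (transition c d) y u)
      (fderiv ℝ (transition c d) y v) := by
  have hp := (extChartAt (𝓡 n) c).map_target hy.1
  obtain ⟨u, rfl⟩ := mvfderiv_chart_surjective hp u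
  obtain ⟨v, rfl⟩ := mvfderiv_chart_surjective hp v
  rw [← mvfderiv_chart_eq_fderiv_transition hy, ← mvfderiv_chart_eq_fderiv_transition hy,
    transition, metricBil_chart g hy.2, ← metricBil_chart g hp u v,
    (extChartAt (𝓡 n) c).right_inv hy.1]

theorem inner_eq_chart (X Y : VField n M) {c p : M} (hp : p ∈ (extChartAt (𝓡 n) c).source) :
    g.inner p (X p) (Y p) = metricBil g c (extChartAt (𝓡 n) c p)
      (fieldRep c X (extChartAt (𝓡 n) c p)) (fieldRep c Y (extChartAt (𝓡 n) c p)) := by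
  rw [fieldRep_chart hp, fieldRep_chart hp, metricBil_chart g hp]

theorem funRep_inner {c : M} {y : Model n} (hy : y ∈ (extChartAt (𝓡 n) c).target)
    (X Y : VField n M) :
    funRep c (fun p ↦ g.inner p (X p) (Y p)) y =
      metricBil g c y (fieldRep c X y) (fieldRep c Y y) := by
  rw [funRep, inner_eq_chart g X Y ((extChartAt (𝓡 n) c).map_target hy),
    (extChartAt (𝓡 n) c).right_inv hy]

theorem metricBil_symm (c : M) (y u v : Model n) :
    metricBil g c y u v = metricBil g c y v u := by
  rw [metricBil_eq_inner, metricBil_eq_inner, g.symm]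

theorem metricBil_pos {c : M} {y : Model n} (hy : y ∈ (extChartAt (𝓡 n) c).target) {u : Model n}
    (hu : u ≠ 0) : 0 < metricBil g c y u u := by
  rw [metricBil_eq_inner]
  refine g.pos _ _ fun h ↦ hu ?_
  rw [← mvfderiv_comp_symm hy u, h]
  exact map_zero (mvfderiv (𝓡 n) (extChartAt (𝓡 n) c) ((extChartAt (𝓡 n) c).symm y))

theorem eq_of_forall_metricBil_eq {c : M} {y : Model n} (hy : y ∈ (extChartAt (𝓡 n) c).target)
    {u v : Model n} (h : ∀ w, metricBil g c y u w = metricBil g c y v w) : u = v := by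
  by_contra huv
  have hpos := metricBil_pos g hy (sub_ne_zero.2 huv)
  rw [map_sub (metricBil g c y), sub_apply, h, sub_self] at hpos
  exact lt_irrefl _ hpos

theorem metricCoord_symm (c : M) (y : Model n) (i j : Fin n) :
    metricCoord g c y i j = metricCoord g c y j i := by
  rw [← metricBil_single, ← metricBil_single, metricBil_symm]

theorem metricCoord_transpose (c : M) (y : Model n) :
    (metricCoord g c y)ᵀ = metricCoord g c y :=
  Matrix.ext fun i j ↦ metricCoord_symm g c y j i

theorem metricCoord_posDef {c : M} {y : Model n} (hy : y ∈ (extChartAt (𝓡 n) c).target) :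
    (metricCoord g c y).PosDef := by
  refine Matrix.PosDef.of_dotProduct_mulVec_pos ?_ fun x hx ↦ ?_
  · rw [Matrix.IsHermitian, Matrix.conjTranspose_eq_transpose_of_trivial, metricCoord_transpose]
  · have hpos := metricBil_pos g hy (u := WithLp.toLp 2 x) (by simpa using hx)
    rw [metricBil_apply] at hpos
    simp only [star_trivial, dotProduct, Matrix.mulVec, Finset.mul_sum]
    exact hpos.trans_eq (Finset.sum_congr rfl fun i _ ↦ Finset.sum_congr rfl fun j _ ↦ by ring)

theorem metricCoord_det_pos {c : M} {y : Model n} (hy : y ∈ (extChartAt (𝓡 n) c).target) :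
    0 < (metricCoord g c y).det :=
  (metricCoord_posDef g hy).det_pos

theorem metricCoord_isUnit {c : M} {y : Model n} (hy : y ∈ (extChartAt (𝓡 n) c).target) :
    IsUnit (metricCoord g c y).det :=
  (metricCoord_det_pos g hy).ne'.isUnit

theorem contDiffOn_metricBil (c : M) :
    ContDiffOn ℝ ∞ (metricBil g c) (extChartAt (𝓡 n) c).target := by
  refine contDiffOn_clm_apply.2 fun u ↦ contDiffOn_clm_apply.2 fun v ↦ ?_
  simp only [metricBil_apply]
  exact ContDiffOn.sum fun i _ ↦ ContDiffOn.sum fun j _ ↦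
    ((contDiffOn_metricCoord g c i j).mul contDiffOn_const).mul contDiffOn_const

theorem hasFDerivAt_metricBil {c : M} {y : Model n} (hy : y ∈ (extChartAt (𝓡 n) c).target) :
    HasFDerivAt (metricBil g c) (fderiv ℝ (metricBil g c) y) y :=
  (differentiableAt_of_contDiffOn_target (contDiffOn_metricBil g c) hy).hasFDerivAt

theorem smoothFunInCharts_inner {X Y : VField n M} (hX : SmoothInCharts X)
    (hY : SmoothInCharts Y) : SmoothFunInCharts (n := n) (fun p ↦ g.inner p (X p) (Y p)) :=
  fun c ↦ (((contDiffOn_metricBil g c).clm_apply (hX c)).clm_apply (hY c)).congr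
    fun _ hy ↦ funRep_inner g hy X Y

theorem contDiffOn_metricCoord_inv (c : M) (i j : Fin n) :
    ContDiffOn ℝ ∞ (fun y ↦ (metricCoord g c y)⁻¹ i j) (extChartAt (𝓡 n) c).target :=
  contDiffOn_matrix_inv (contDiffOn_metricCoord g c) (fun _ hy ↦ (metricCoord_det_pos g hy).ne') i j

theorem contDiffOn_christoffel (c : M) (k i j : Fin n) :
    ContDiffOn ℝ ∞ (christoffel g c k i j) (extChartAt (𝓡 n) c).target := by
  have hpd := fun i j k ↦ contDiffOn_pd (isOpen_chartTarget c) (contDiffOn_metricCoord g c j k) i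
  exact contDiffOn_const.mul (ContDiffOn.sum fun l _ ↦
    (contDiffOn_metricCoord_inv g c k l).mul (((hpd i j l).add (hpd j i l)).sub (hpd l i j)))

theorem fderiv_metricBil_apply {c : M} {y : Model n} (hy : y ∈ (extChartAt (𝓡 n) c).target)
    (u v w : Model n) :
    fderiv ℝ (fun z ↦ metricBil g c z v w) y u = fderiv ℝ (metricBil g c) y u v w := by
  rw [(((hasFDerivAt_metricBil g hy).clm_apply (hasFDerivAt_const v y)).clm_apply
    (hasFDerivAt_const w y)).fderiv]
  simp

theorem fderiv_metricBil_symm {c : M} {y : Model n} (hy : y ∈ (extChartAt (𝓡 n) c).target)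
    (u v w : Model n) :
    fderiv ℝ (metricBil g c) y u v w = fderiv ℝ (metricBil g c) y u w v := by
  rw [← fderiv_metricBil_apply g hy, ← fderiv_metricBil_apply g hy]
  simp only [metricBil_symm g c _ v w]

theorem pd_metricCoord {c : M} {y : Model n} (hy : y ∈ (extChartAt (𝓡 n) c).target)
    (i j k : Fin n) :
    pd i (fun z ↦ metricCoord g c z j k) y = fderiv ℝ (metricBil g c) y
      (EuclideanSpace.single i 1) (EuclideanSpace.single j 1) (EuclideanSpace.single k 1) := by
  rw [pd, ← fderiv_metricBil_apply g hy]
  simp only [metricBil_single]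

theorem fderiv_metricBil_transition {c d : M} {y : Model n} (hy : y ∈ overlap c d)
    (u v w : Model n) :
    fderiv ℝ (metricBil g c) y u v w =
      fderiv ℝ (metricBil g d) (transition c d y) (fderiv ℝ (transition c d) y u)
          (fderiv ℝ (transition c d) y v) (fderiv ℝ (transition c d) y w)
        + metricBil g d (transition c d y) (fderiv ℝ (fderiv ℝ (transition c d)) y u v)
          (fderiv ℝ (transition c d) y w)
        + metricBil g d (transition c d y) (fderiv ℝ (transition c d) y v)
          (fderiv ℝ (fderiv ℝ (transition c d)) y u w) := by
  have hpull : (fun z ↦ metricBil g c z v w) =ᶠ[𝓝 y] fun z ↦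
      metricBil g d (transition c d z) (fderiv ℝ (transition c d) z v)
        (fderiv ℝ (transition c d) z w) := by
    filter_upwards [(isOpen_overlap c d).mem_nhds hy] with z hz
    exact metricBil_transition g hz v w
  have hτ' := hasFDerivAt_fderiv (contDiffAt_transition hy)
  have hg := (hasFDerivAt_metricBil g (transition_mem_target hy)).comp y (hasFDerivAt_transition hy)
  have hderiv := ((hg.clm_apply (hτ'.clm_apply (hasFDerivAt_const v y))).clm_apply
    (hτ'.clm_apply (hasFDerivAt_const w y))).fderiv
  simp only [Function.comp_apply] at hderiv
  rw [← fderiv_metricBil_apply g hy.1, hpull.fderiv_eq, hderiv]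
  simp
  ring

end MetricForm

section CovariantDerivative

theorem sum_sum_sum_reverse {ι κ τ R : Type*} [Fintype ι] [Fintype κ] [Fintype τ]
    [AddCommMonoid R] (f : ι → κ → τ → R) :
    ∑ a, ∑ b, ∑ c, f a b c = ∑ c, ∑ b, ∑ a, f a b c :=
  calc ∑ a, ∑ b, ∑ c, f a b c
      = ∑ a, ∑ c, ∑ b, f a b c := Finset.sum_congr rfl fun _ _ ↦ Finset.sum_comm
    _ = ∑ c, ∑ a, ∑ b, f a b c := Finset.sum_comm
    _ = ∑ c, ∑ b, ∑ a, f a b c := Finset.sum_congr rfl fun _ _ ↦ Finset.sum_comm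

variable {n : ℕ} {M : Type*} [TopologicalSpace M] [ChartedSpace (Model n) M]
  [IsManifold (𝓡 n) ∞ M] (g : Metric n M)

theorem christoffel_symm (c : M) (k i j : Fin n) (y : Model n) :
    christoffel g c k i j y = christoffel g c k j i y := by
  simp only [christoffel, metricCoord_symm g c _ i j]
  congr 1
  exact Finset.sum_congr rfl fun l _ ↦ by ring

theorem sum_christoffel_mul_metricCoord {c : M} {y : Model n}
    (hy : y ∈ (extChartAt (𝓡 n) c).target) (i j l : Fin n) :
    ∑ k, christoffel g c k i j y * metricCoord g c y k l =
      (1 / 2) * (pd i (fun z ↦ metricCoord g c z j l) y + pd j (fun z ↦ metricCoord g c z i l) y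
        - pd l (fun z ↦ metricCoord g c z i j) y) := by
  set a : Fin n → ℝ := fun l ↦ (1 / 2) * (pd i (fun z ↦ metricCoord g c z j l) y
    + pd j (fun z ↦ metricCoord g c z i l) y - pd l (fun z ↦ metricCoord g c z i j) y) with ha
  have hraise : (fun k ↦ christoffel g c k i j y) = (metricCoord g c y)⁻¹ *ᵥ a := by
    funext k
    simp only [christoffel, Matrix.mulVec, dotProduct, ha, Finset.mul_sum]
    exact Finset.sum_congr rfl fun l _ ↦ by ring
  calc ∑ k, christoffel g c k i j y * metricCoord g c y k l
      = (metricCoord g c y *ᵥ fun k ↦ christoffel g c k i j y) l :=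
        Finset.sum_congr rfl fun k _ ↦ by rw [metricCoord_symm g c y k l, mul_comm]
    _ = a l := by
        rw [hraise, Matrix.mulVec_mulVec, Matrix.mul_nonsing_inv _ (metricCoord_isUnit g hy),
          Matrix.one_mulVec]

/-- The vector `Γ(u, v)` with components `Γᵏ_{ij} uⁱ vʲ`. -/
def christoffelMap (c : M) (y u v : Model n) : Model n :=
  WithLp.toLp 2 fun k ↦ ∑ i, ∑ j, christoffel g c k i j y * u i * v j

theorem christoffelMap_symm (c : M) (y u v : Model n) :
    christoffelMap g c y u v = christoffelMap g c y v u := by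
  ext k
  change ∑ i, ∑ j, christoffel g c k i j y * u i * v j
    = ∑ i, ∑ j, christoffel g c k i j y * v i * u j
  rw [Finset.sum_comm]
  exact Finset.sum_congr rfl fun i _ ↦ Finset.sum_congr rfl fun j _ ↦ by
    rw [christoffel_symm]; ring

theorem fderiv_metricBil_eq_sum {c : M} {y : Model n} (hy : y ∈ (extChartAt (𝓡 n) c).target)
    (u v w : Model n) :
    fderiv ℝ (metricBil g c) y u v w =
      ∑ i, ∑ j, ∑ l, u i * v j * w l * pd i (fun z ↦ metricCoord g c z j l) y := by
  simp only [pd_metricCoord g hy]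
  conv_lhs => rw [eq_sum_single u, eq_sum_single v, eq_sum_single w]
  simp only [map_sum, map_smul, sum_apply, smul_apply, smul_eq_mul, Finset.mul_sum]
  rw [sum_sum_sum_reverse]
  exact Finset.sum_congr rfl fun i _ ↦ Finset.sum_congr rfl fun j _ ↦
    Finset.sum_congr rfl fun l _ ↦ by ring

theorem metricBil_christoffelMap {c : M} {y : Model n} (hy : y ∈ (extChartAt (𝓡 n) c).target)
    (u v w : Model n) :
    metricBil g c y (christoffelMap g c y u v) w = (1 / 2) * (fderiv ℝ (metricBil g c) y u v w
      + fderiv ℝ (metricBil g c) y v u w - fderiv ℝ (metricBil g c) y w u v) := by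
  have hlower : metricBil g c y (christoffelMap g c y u v) w =
      ∑ i, ∑ j, ∑ l, u i * v j * w l * ∑ k, christoffel g c k i j y * metricCoord g c y k l := by
    simp only [metricBil_apply, christoffelMap, Finset.mul_sum, Finset.sum_mul]
    rw [Finset.sum_congr rfl fun k _ ↦ sum_sum_sum_reverse _, sum_sum_sum_reverse]
    refine Finset.sum_congr rfl fun i _ ↦ Finset.sum_congr rfl fun j _ ↦ ?_
    rw [Finset.sum_comm]
    exact Finset.sum_congr rfl fun l _ ↦ Finset.sum_congr rfl fun k _ ↦ by ring
  have hswap : fderiv ℝ (metricBil g c) y v u w =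
      ∑ i, ∑ j, ∑ l, u i * v j * w l * pd j (fun z ↦ metricCoord g c z i l) y := by
    rw [fderiv_metricBil_eq_sum g hy, Finset.sum_comm]
    exact Finset.sum_congr rfl fun i _ ↦ Finset.sum_congr rfl fun j _ ↦
      Finset.sum_congr rfl fun l _ ↦ by ring
  have hcycle : fderiv ℝ (metricBil g c) y w u v =
      ∑ i, ∑ j, ∑ l, u i * v j * w l * pd l (fun z ↦ metricCoord g c z i j) y := by
    rw [fderiv_metricBil_eq_sum g hy, Finset.sum_comm]
    refine Finset.sum_congr rfl fun i _ ↦ ?_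
    rw [Finset.sum_comm]
    exact Finset.sum_congr rfl fun j _ ↦ Finset.sum_congr rfl fun l _ ↦ by ring
  rw [hlower, hswap, hcycle, fderiv_metricBil_eq_sum g hy]
  simp only [sum_christoffel_mul_metricCoord g hy, Finset.mul_sum, ← Finset.sum_add_distrib,
    ← Finset.sum_sub_distrib]
  exact Finset.sum_congr rfl fun i _ ↦ Finset.sum_congr rfl fun j _ ↦
    Finset.sum_congr rfl fun l _ ↦ by ring

theorem fderiv_metricBil_eq_christoffelMap {c : M} {y : Model n}
    (hy : y ∈ (extChartAt (𝓡 n) c).target) (u v w : Model n) :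
    fderiv ℝ (metricBil g c) y u v w = metricBil g c y (christoffelMap g c y u v) w
      + metricBil g c y v (christoffelMap g c y u w) := by
  rw [metricBil_symm g c y v, metricBil_christoffelMap g hy, metricBil_christoffelMap g hy,
    fderiv_metricBil_symm g hy u w v]
  ring

theorem fderiv_transition_christoffelMap {c d : M} {y : Model n} (hy : y ∈ overlap c d)
    (u v : Model n) :
    fderiv ℝ (transition c d) y (christoffelMap g c y u v) =
      fderiv ℝ (fderiv ℝ (transition c d)) y u v
        + christoffelMap g d (transition c d y) (fderiv ℝ (transition c d) y u)
          (fderiv ℝ (transition c d) y v) := by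
  refine eq_of_forall_metricBil_eq g (transition_mem_target hy) fun w ↦ ?_
  obtain ⟨w, rfl⟩ := (fderiv_transition_bijective hy).2 w
  have hsymm := fderiv_fderiv_comm (contDiffAt_transition hy)
  rw [← metricBil_transition g hy, metricBil_christoffelMap g hy.1,
    map_add (metricBil g d (transition c d y)), add_apply,
    metricBil_christoffelMap g (transition_mem_target hy), fderiv_metricBil_transition g hy,
    fderiv_metricBil_transition g hy, fderiv_metricBil_transition g hy, hsymm v u, hsymm w u,
    hsymm w v, metricBil_symm g d _ _ (fderiv ℝ (fderiv ℝ (transition c d)) y u w),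
    metricBil_symm g d _ _ (fderiv ℝ (fderiv ℝ (transition c d)) y v w)]
  ring

/-- The endomorphism `u ↦ ∇_u X` in the chart at `c`. -/
def covLin (c : M) (X : VField n M) (y : Model n) : Model n →ₗ[ℝ] Model n :=
  Matrix.toLin (EuclideanSpace.basisFun (Fin n) ℝ).toBasis
    (EuclideanSpace.basisFun (Fin n) ℝ).toBasis (Matrix.of fun k i ↦ covCoord g c X y i k)

theorem covLin_apply (c : M) (X : VField n M) (y u : Model n) (k : Fin n) :
    covLin g c X y u k = ∑ i, u i * covCoord g c X y i k := by
  simp [covLin, Matrix.toLin_apply, Matrix.mulVec, dotProduct, mul_comm, Pi.single_apply]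

theorem covLin_single (c : M) (X : VField n M) (y : Model n) (i k : Fin n) :
    covLin g c X y (EuclideanSpace.single i 1) k = covCoord g c X y i k := by
  simp [covLin_apply]

theorem metricBil_covLin_single (c : M) (X : VField n M) (y : Model n) (i l : Fin n) :
    metricBil g c y (covLin g c X y (EuclideanSpace.single i 1)) (EuclideanSpace.single l 1) =
      ∑ k, covCoord g c X y i k * metricCoord g c y k l := by
  simp [metricBil_apply, covLin_single, mul_comm]

theorem covLin_eq {X : VField n M} (hX : SmoothInCharts X) {c : M} {y : Model n}
    (hy : y ∈ (extChartAt (𝓡 n) c).target) (u : Model n) :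
    covLin g c X y u =
      fderiv ℝ (fieldRep c X) y u + christoffelMap g c y u (fieldRep c X y) := by
  ext k
  rw [covLin_apply, PiLp.add_apply]
  simp only [covCoord, pd_vecCoord hX hy, mul_add, Finset.sum_add_distrib, Finset.mul_sum]
  congr 1
  · conv_rhs => rw [eq_sum_single u]
    simp
  · exact Finset.sum_congr rfl fun i _ ↦ Finset.sum_congr rfl fun j _ ↦ by
      change u i * (christoffel g c k i j y * fieldRep c X y j) = _
      ring

theorem covLin_transition {c d : M} {y : Model n} (hy : y ∈ overlap c d)
    {X : VField n M} (hX : SmoothInCharts X) (u : Model n) :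
    covLin g d X (transition c d y) (fderiv ℝ (transition c d) y u) =
      fderiv ℝ (transition c d) y (covLin g c X y u) := by
  rw [covLin_eq g hX (transition_mem_target hy), covLin_eq g hX hy.1, map_add,
    fderiv_fieldRep_transition hy hX, fderiv_transition_christoffelMap g hy,
    fieldRep_transition hy]
  abel

theorem fderiv_metricBil_fieldRep {X : VField n M} (hX : SmoothInCharts X) {c : M} {y : Model n}
    (hy : y ∈ (extChartAt (𝓡 n) c).target) {f : Model n → Model n} (hf : DifferentiableAt ℝ f y)
    (u : Model n) :
    fderiv ℝ (fun z ↦ metricBil g c z (fieldRep c X z) (f z)) y u =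
      metricBil g c y (covLin g c X y u) (f y)
        + metricBil g c y (fieldRep c X y) (fderiv ℝ f y u + christoffelMap g c y u (f y)) := by
  rw [(((hasFDerivAt_metricBil g hy).clm_apply (hX.differentiableAt hy).hasFDerivAt).clm_apply
    hf.hasFDerivAt).fderiv, covLin_eq g hX hy]
  simp [fderiv_metricBil_eq_christoffelMap g hy]
  ring

theorem lieCoord_eq {X : VField n M} (hX : SmoothInCharts X) {c : M} {y : Model n}
    (hy : y ∈ (extChartAt (𝓡 n) c).target) (i j : Fin n) :
    lieCoord g c X y i j = ∑ k, covCoord g c X y i k * metricCoord g c y k j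
      + ∑ k, covCoord g c X y j k * metricCoord g c y k i := by
  have hcoord : lieCoord g c X y i j =
      fderiv ℝ (metricBil g c) y (fieldRep c X y) (EuclideanSpace.single i 1)
          (EuclideanSpace.single j 1)
        + metricBil g c y (fderiv ℝ (fieldRep c X) y (EuclideanSpace.single i 1))
          (EuclideanSpace.single j 1)
        + metricBil g c y (fderiv ℝ (fieldRep c X) y (EuclideanSpace.single j 1))
          (EuclideanSpace.single i 1) := by
    rw [← fderiv_metricBil_apply g hy, fderiv_eq_sum_pd, metricBil_apply, metricBil_apply]
    simp only [lieCoord, Matrix.of_apply, metricBil_single, ← pd_vecCoord hX hy,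
      PiLp.single_apply, mul_ite,
      mul_one, mul_zero, Finset.sum_ite_eq', Finset.mem_univ, if_true, ← Finset.sum_add_distrib]
    exact Finset.sum_congr rfl fun k _ ↦ by rw [metricCoord_symm g c y i k]; rfl
  rw [hcoord, ← metricBil_covLin_single, ← metricBil_covLin_single, covLin_eq g hX hy,
    covLin_eq g hX hy, fderiv_metricBil_eq_christoffelMap g hy,
    christoffelMap_symm g c y _ (fieldRep c X y), christoffelMap_symm g c y _ (fieldRep c X y),
    metricBil_symm g c y (EuclideanSpace.single i 1)]
  simp only [map_add, add_apply]
  ring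

theorem trace_covLin (c : M) (X : VField n M) (y : Model n) :
    LinearMap.trace ℝ _ (covLin g c X y) = ∑ i, covCoord g c X y i i := by
  rw [covLin, Matrix.trace_toLin_eq]
  rfl

theorem trace_covLin_comp (c : M) (X Y : VField n M) (y : Model n) :
    LinearMap.trace ℝ _ (covLin g c X y ∘ₗ covLin g c Y y) =
      ∑ i, ∑ j, covCoord g c X y i j * covCoord g c Y y j i := by
  rw [covLin, covLin, ← Matrix.toLin_mul, Matrix.trace_toLin_eq]
  simp only [Matrix.trace, Matrix.diag, Matrix.mul_apply, Matrix.of_apply]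
  rw [Finset.sum_comm]

theorem covLin_transition_conj {c d : M} {y : Model n} (hy : y ∈ overlap c d) :
    ∃ e : Model n ≃ₗ[ℝ] Model n, ∀ X : VField n M, SmoothInCharts X →
      covLin g d X (transition c d y) = e.conj (covLin g c X y) := by
  let e : Model n ≃ₗ[ℝ] Model n := LinearEquiv.ofBijective
    (fderiv ℝ (transition c d) y).toLinearMap (fderiv_transition_bijective hy)
  refine ⟨e, fun X hX ↦ LinearMap.ext fun w ↦ ?_⟩
  obtain ⟨u, rfl⟩ := e.surjective w
  rw [LinearEquiv.conj_apply_apply, e.symm_apply_apply]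
  exact covLin_transition g hy hX u

theorem sum_covCoord_transition {c d : M} {y : Model n} (hy : y ∈ overlap c d)
    {X : VField n M} (hX : SmoothInCharts X) :
    ∑ i, covCoord g d X (transition c d y) i i = ∑ i, covCoord g c X y i i := by
  obtain ⟨e, he⟩ := covLin_transition_conj g hy
  rw [← trace_covLin, ← trace_covLin, he X hX, LinearMap.trace_conj']

theorem sum_covCoord_mul_covCoord_transition {c d : M} {y : Model n} (hy : y ∈ overlap c d)
    {X Y : VField n M} (hX : SmoothInCharts X) (hY : SmoothInCharts Y) :
    ∑ i, ∑ j, covCoord g d X (transition c d y) i j * covCoord g d Y (transition c d y) j i =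
      ∑ i, ∑ j, covCoord g c X y i j * covCoord g c Y y j i := by
  obtain ⟨e, he⟩ := covLin_transition_conj g hy
  rw [← trace_covLin_comp, ← trace_covLin_comp, he X hX, he Y hY, ← LinearEquiv.conj_comp,
    LinearMap.trace_conj']

end CovariantDerivative

section GlobalOperators

variable {n : ℕ} {M : Type*} [TopologicalSpace M] [ChartedSpace (Model n) M]
  [IsManifold (𝓡 n) ∞ M] (g : Metric n M)

theorem contDiffOn_covCoord {X : VField n M} (hX : SmoothInCharts X) (c : M) (i k : Fin n) :
    ContDiffOn ℝ ∞ (fun y ↦ covCoord g c X y i k) (extChartAt (𝓡 n) c).target :=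
  (contDiffOn_pd (isOpen_chartTarget c) (hX.coord c k) i).add
    (ContDiffOn.sum fun j _ ↦ (contDiffOn_christoffel g c k i j).mul (hX.coord c j))

theorem covCoord_sum {ι : Type*} (s : Finset ι) {X : ι → VField n M}
    (hX : ∀ a ∈ s, SmoothInCharts (X a)) {c : M} {y : Model n}
    (hy : y ∈ (extChartAt (𝓡 n) c).target) (i k : Fin n) :
    covCoord g c (fun p ↦ ∑ a ∈ s, X a p) y i k = ∑ a ∈ s, covCoord g c (X a) y i k := by
  have hcoord : ∀ k z, vecCoord c (fun p ↦ ∑ a ∈ s, X a p) z k = ∑ a ∈ s, vecCoord c (X a) z k :=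
    fun k z ↦ by
    simpa using! congrArg (fun w : Model n ↦ w k) (fieldRep_sum s c X z)
  simp only [covCoord, hcoord, Finset.sum_add_distrib]
  rw [pd_sum fun a ha ↦ differentiableAt_of_contDiffOn_target ((hX a ha).coord c k) hy]
  simp only [Finset.mul_sum]
  rw [Finset.sum_comm]

theorem covCoord_add {X Y : VField n M} (hX : SmoothInCharts X) (hY : SmoothInCharts Y) {c : M}
    {y : Model n} (hy : y ∈ (extChartAt (𝓡 n) c).target) (i k : Fin n) :
    covCoord g c (fun p ↦ X p + Y p) y i k = covCoord g c X y i k + covCoord g c Y y i k := by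
  simpa [Fin.sum_univ_two] using
    covCoord_sum g Finset.univ (X := ![X, Y]) (by simp [Fin.forall_fin_two, hX, hY]) hy i k

theorem divergence_eq_chart {X : VField n M} (hX : SmoothInCharts X) {c p : M}
    (hp : p ∈ (extChartAt (𝓡 n) c).source) :
    divergence g X p = ∑ i, covCoord g c X (extChartAt (𝓡 n) c p) i i := by
  rw [← sum_covCoord_transition g (chart_mem_overlap hp (mem_extChartAt_source p)) hX,
    transition_chart hp]
  rfl

theorem divergence_sum {ι : Type*} (s : Finset ι) {X : ι → VField n M}
    (hX : ∀ a ∈ s, SmoothInCharts (X a)) (p : M) :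
    divergence g (fun q ↦ ∑ a ∈ s, X a q) p = ∑ a ∈ s, divergence g (X a) p := by
  simp only [divergence, covCoord_sum g s hX (base_mem_target p)]
  exact Finset.sum_comm

theorem funRep_divergence {X : VField n M} (hX : SmoothInCharts X) {c : M} {y : Model n}
    (hy : y ∈ (extChartAt (𝓡 n) c).target) :
    funRep c (divergence g X) y = ∑ i, covCoord g c X y i i := by
  rw [funRep, divergence_eq_chart g hX ((extChartAt (𝓡 n) c).map_target hy),
    (extChartAt (𝓡 n) c).right_inv hy]

theorem continuous_divergence {X : VField n M} (hX : SmoothInCharts X) :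
    Continuous (divergence g X) :=
  continuous_of_chart (fun c y ↦ ∑ i, covCoord g c X y i i)
    (fun c ↦ continuousOn_finsetSum _ fun i _ ↦ (contDiffOn_covCoord g hX c i i).continuousOn)
    fun _ _ hp ↦ divergence_eq_chart g hX hp

/-- The trace of `∇X ∘ ∇Y`. -/
def covTrace (X Y : VField n M) (p : M) : ℝ :=
  ∑ i, ∑ j, covCoord g p X (base p) i j * covCoord g p Y (base p) j i

theorem covTrace_eq_chart {X Y : VField n M} (hX : SmoothInCharts X) (hY : SmoothInCharts Y)
    {c p : M} (hp : p ∈ (extChartAt (𝓡 n) c).source) :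
    covTrace g X Y p = ∑ i, ∑ j, covCoord g c X (extChartAt (𝓡 n) c p) i j *
      covCoord g c Y (extChartAt (𝓡 n) c p) j i := by
  rw [← sum_covCoord_mul_covCoord_transition g
    (chart_mem_overlap hp (mem_extChartAt_source p)) hX hY, transition_chart hp]
  rfl

theorem continuous_covTrace {X Y : VField n M} (hX : SmoothInCharts X) (hY : SmoothInCharts Y) :
    Continuous (covTrace g X Y) :=
  continuous_of_chart (fun c y ↦ ∑ i, ∑ j, covCoord g c X y i j * covCoord g c Y y j i)
    (fun c ↦ continuousOn_finsetSum _ fun i _ ↦ continuousOn_finsetSum _ fun j _ ↦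
      (contDiffOn_covCoord g hX c i j).continuousOn.mul
        (contDiffOn_covCoord g hY c j i).continuousOn)
    fun _ _ hp ↦ covTrace_eq_chart g hX hY hp

theorem exists_covField (V Y : VField n M) (p : M) :
    ∃ w : TangentSpace (𝓡 n) p, mvfderiv (𝓡 n) (extChartAt (𝓡 n) p) p w =
      covLin g p Y (base p) (fieldRep p V (base p)) :=
  mvfderiv_chart_surjective (mem_extChartAt_source p) _

/-- The vector field `∇_V Y`, given at `p` by its components `Vⁱ ∇ᵢ Yᵏ` in the preferred chart at
`p`. -/
def covField (V Y : VField n M) : VField n M := fun p ↦ (exists_covField g V Y p).choose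

theorem fieldRep_covField (V : VField n M) {Y : VField n M} (hY : SmoothInCharts Y) {c : M}
    {y : Model n} (hy : y ∈ (extChartAt (𝓡 n) c).target) :
    fieldRep c (covField g V Y) y = covLin g c Y y (fieldRep c V y) := by
  obtain ⟨p, hp, rfl⟩ : ∃ p ∈ (extChartAt (𝓡 n) c).source, extChartAt (𝓡 n) c p = y :=
    ⟨_, (extChartAt (𝓡 n) c).map_target hy, (extChartAt (𝓡 n) c).right_inv hy⟩
  have hoverlap : (base p : Model n) ∈ overlap p c := chart_mem_overlap (mem_extChartAt_source p) hp
  have htransition : transition p c (base p : Model n) = extChartAt (𝓡 n) c p :=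
    transition_chart (mem_extChartAt_source p)
  have hbase : fieldRep p (covField g V Y) (base p) =
      covLin g p Y (base p) (fieldRep p V (base p)) :=
    (fieldRep_chart (mem_extChartAt_source p) _).trans (exists_covField g V Y p).choose_spec
  rw [← htransition, fieldRep_transition hoverlap, fieldRep_transition hoverlap, hbase,
    covLin_transition g hoverlap hY]

theorem vecCoord_covField (V : VField n M) {Y : VField n M} (hY : SmoothInCharts Y) {c : M}
    {y : Model n} (hy : y ∈ (extChartAt (𝓡 n) c).target) (k : Fin n) :
    vecCoord c (covField g V Y) y k = ∑ j, vecCoord c V y j * covCoord g c Y y j k := by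
  change fieldRep c (covField g V Y) y k = _
  rw [fieldRep_covField g V hY hy, covLin_apply]
  rfl

theorem SmoothInCharts.covField {V Y : VField n M} (hV : SmoothInCharts V)
    (hY : SmoothInCharts Y) : SmoothInCharts (covField g V Y) := fun c ↦ by
  refine contDiffOn_euclidean.2 fun k ↦ ContDiffOn.congr ?_
    fun y hy ↦ vecCoord_covField g V hY hy k
  exact ContDiffOn.sum fun j _ ↦ (hV.coord c j).mul (contDiffOn_covCoord g hY c j k)

end GlobalOperators

section Gradient

variable {n : ℕ} {M : Type*} [TopologicalSpace M] [ChartedSpace (Model n) M]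
  [IsManifold (𝓡 n) ∞ M] (g : Metric n M) {h : M → ℝ}

theorem inner_grad (h : M → ℝ) (p : M) (v : TangentSpace (𝓡 n) p) :
    g.inner p (grad g h p) v = mvfderiv (𝓡 n) h p v :=
  LinearMap.BilinForm.apply_toDual_symm_apply (hB := metricForm_nondegenerate g p)
    (mvfderiv (𝓡 n) h p : TangentSpace (𝓡 n) p →ₗ[ℝ] ℝ) v

theorem metricBil_grad (hh : ContMDiff (𝓡 n) 𝓘(ℝ, ℝ) ∞ h) {c : M} {y : Model n}
    (hy : y ∈ (extChartAt (𝓡 n) c).target) (w : Model n) :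
    metricBil g c y (fieldRep c (grad g h) y) w = fderiv ℝ (funRep c h) y w := by
  have hp := (extChartAt (𝓡 n) c).map_target hy
  obtain ⟨w, rfl⟩ := mvfderiv_chart_surjective hp w
  have hinner := metricBil_chart g hp (grad g h _) w
  rw [(extChartAt (𝓡 n) c).right_inv hy, inner_grad,
    mvfderiv_eq_fderiv_comp_symm hy (hh.mdifferentiable (by simp) _)] at hinner
  exact hinner

theorem diffCoord_eq (hh : ContMDiff (𝓡 n) 𝓘(ℝ, ℝ) ∞ h) {c : M} {y : Model n}
    (hy : y ∈ (extChartAt (𝓡 n) c).target) :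
    diffCoord c h y = metricCoord g c y *ᵥ vecCoord c (grad g h) y := by
  funext l
  change fderiv ℝ (funRep c h) y (EuclideanSpace.single l 1) = _
  rw [← metricBil_grad g hh hy, metricBil_symm, metricBil_apply]
  simp [Matrix.mulVec, dotProduct, vecCoord, fieldRep]

theorem vecCoord_grad (hh : ContMDiff (𝓡 n) 𝓘(ℝ, ℝ) ∞ h) {c : M} {y : Model n}
    (hy : y ∈ (extChartAt (𝓡 n) c).target) :
    vecCoord c (grad g h) y = (metricCoord g c y)⁻¹ *ᵥ diffCoord c h y := by
  rw [diffCoord_eq g hh hy, Matrix.mulVec_mulVec,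
    Matrix.nonsing_inv_mul _ (metricCoord_isUnit g hy), Matrix.one_mulVec]

theorem smoothInCharts_grad (hh : ContMDiff (𝓡 n) 𝓘(ℝ, ℝ) ∞ h) : SmoothInCharts (grad g h) :=
  fun c ↦ by
  refine contDiffOn_euclidean.2 fun k ↦ ContDiffOn.congr ?_
    fun y hy ↦ congrFun (vecCoord_grad g hh hy) k
  simp only [Matrix.mulVec, dotProduct]
  exact ContDiffOn.sum fun l _ ↦ (contDiffOn_metricCoord_inv g c k l).mul
    (contDiffOn_pd (isOpen_chartTarget c) (smoothFunInCharts_of_contMDiff hh c) l)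

theorem hessCoord_eq (hh : ContMDiff (𝓡 n) 𝓘(ℝ, ℝ) ∞ h) {c : M} {y : Model n}
    (hy : y ∈ (extChartAt (𝓡 n) c).target) (i l : Fin n) :
    hessCoord g c h y i l = ∑ k, covCoord g c (grad g h) y i k * metricCoord g c y k l := by
  have hdiff : (fun z ↦ diffCoord c h z l) =ᶠ[𝓝 y] fun z ↦
      metricBil g c z (fieldRep c (grad g h) z) (EuclideanSpace.single l 1) := by
    filter_upwards [(isOpen_chartTarget c).mem_nhds hy] with z hz
    exact (metricBil_grad g hh hz _).symm
  have hchristoffel : ∑ k, christoffel g c k i l y * diffCoord c h y k =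
      metricBil g c y (fieldRep c (grad g h) y) (christoffelMap g c y (EuclideanSpace.single i 1)
        (EuclideanSpace.single l 1)) := by
    have hsingle : ∀ k, christoffelMap g c y (EuclideanSpace.single i 1)
        (EuclideanSpace.single l 1) k = christoffel g c k i l y := by simp [christoffelMap]
    rw [metricBil_grad g hh hy, fderiv_eq_sum_pd]
    exact Finset.sum_congr rfl fun k _ ↦ by rw [hsingle]; rfl
  rw [hessCoord, Matrix.of_apply, pd_congr hdiff, pd,
    fderiv_metricBil_fieldRep g (smoothInCharts_grad g hh) hy (differentiableAt_const _),
    hchristoffel, metricBil_covLin_single]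
  simp

theorem hessCoord_symm (hh : ContMDiff (𝓡 n) 𝓘(ℝ, ℝ) ∞ h) {c : M} {y : Model n}
    (hy : y ∈ (extChartAt (𝓡 n) c).target) (i j : Fin n) :
    hessCoord g c h y i j = hessCoord g c h y j i := by
  simp only [hessCoord, Matrix.of_apply, christoffel_symm g c _ i j]
  congr 1
  exact pd_comm (contDiffAt_of_contDiffOn_target (smoothFunInCharts_of_contMDiff hh c) hy) i j

theorem divergence_smul {f : M → ℝ} (hf : SmoothFunInCharts (n := n) f) {X : VField n M}
    (hX : SmoothInCharts X) (p : M) :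
    divergence g (fun q ↦ f q • X q) p =
      fderiv ℝ (funRep p f) (base p) (fieldRep p X (base p)) + f p * divergence g X p := by
  have hy := base_mem_target (n := n) p
  have hcoord : ∀ z k, vecCoord p (fun q ↦ f q • X q) z k = funRep p f z * vecCoord p X z k :=
    fun z k ↦ congrArg (fun w : Model n ↦ w k) (fieldRep_smul p f X z)
  have hbase : funRep p f (base p : Model n) = f p := funRep_chart (mem_extChartAt_source p) f
  simp only [divergence, covCoord, hcoord]
  rw [fderiv_eq_sum_pd, Finset.mul_sum, ← Finset.sum_add_distrib]
  refine Finset.sum_congr rfl fun i _ ↦ ?_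
  rw [pd_mul (differentiableAt_of_contDiffOn_target (hf p) hy)
    (differentiableAt_of_contDiffOn_target (hX.coord p i) hy), hbase, mul_add, Finset.mul_sum,
    add_assoc, mul_comm (pd i _ _)]
  congr 2
  exact Finset.sum_congr rfl fun j _ ↦ by ring

theorem divergence_smul_of_contMDiff {f : M → ℝ} (hf : ContMDiff (𝓡 n) 𝓘(ℝ, ℝ) ∞ f)
    {X : VField n M} (hX : SmoothInCharts X) (p : M) :
    divergence g (fun q ↦ f q • X q) p =
      g.inner p (grad g f p) (X p) + f p * divergence g X p := by
  rw [divergence_smul g (smoothFunInCharts_of_contMDiff hf) hX,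
    ← metricBil_grad g hf (base_mem_target p),
    inner_eq_chart g (grad g f) X (mem_extChartAt_source p)]
  rfl

theorem divergence_normSq_smul {X : VField n M} (hX : SmoothInCharts X) (p : M) :
    divergence g (fun q ↦ normSq g X q • X q) p =
      2 * metricBil g p (base p) (covLin g p X (base p) (fieldRep p X (base p)))
          (fieldRep p X (base p))
        + normSq g X p * divergence g X p := by
  have hy := base_mem_target (n := n) p
  have hnormSq : funRep p (normSq g X) =ᶠ[𝓝 (base p)] fun z ↦
      metricBil g p z (fieldRep p X z) (fieldRep p X z) := by
    filter_upwards [(isOpen_chartTarget p).mem_nhds hy] with z hz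
    exact funRep_inner g hz X X
  rw [divergence_smul (f := normSq g X) g (smoothFunInCharts_inner g hX hX) hX,
    hnormSq.fderiv_eq, fderiv_metricBil_fieldRep g hX hy (hX.differentiableAt hy),
    ← covLin_eq g hX hy, metricBil_symm g p _ (fieldRep p X _)]
  ring

end Gradient

section CommutationFormula

variable {n : ℕ} {M : Type*} [TopologicalSpace M] [ChartedSpace (Model n) M]
  [IsManifold (𝓡 n) ∞ M] (g : Metric n M)

theorem pd_covCoord {Y : VField n M} (hY : SmoothInCharts Y) {c : M} {y : Model n}
    (hy : y ∈ (extChartAt (𝓡 n) c).target) (l i k : Fin n) :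
    pd l (fun z ↦ covCoord g c Y z i k) y = pd l (pd i fun z ↦ vecCoord c Y z k) y
      + ∑ j, (pd l (christoffel g c k i j) y * vecCoord c Y y j
        + christoffel g c k i j y * pd l (fun z ↦ vecCoord c Y z j) y) := by
  have hchristoffel := fun j ↦
    differentiableAt_of_contDiffOn_target (contDiffOn_christoffel g c k i j) hy
  have hcoord := fun j ↦ differentiableAt_of_contDiffOn_target (hY.coord c j) hy
  have hpd := differentiableAt_of_contDiffOn_target
    (contDiffOn_pd (isOpen_chartTarget c) (hY.coord c k) i) hy
  unfold covCoord
  rw [pd_add hpd (DifferentiableAt.fun_sum fun j _ ↦ (hchristoffel j).fun_mul (hcoord j)),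
    pd_sum fun j _ ↦ (hchristoffel j).fun_mul (hcoord j)]
  simp only [fun j ↦ pd_mul (hchristoffel j) (hcoord j) l]

theorem pd_vecCoord_covField {V Y : VField n M} (hV : SmoothInCharts V) (hY : SmoothInCharts Y)
    {c : M} {y : Model n} (hy : y ∈ (extChartAt (𝓡 n) c).target) (l k : Fin n) :
    pd l (fun z ↦ vecCoord c (covField g V Y) z k) y =
      ∑ j, (pd l (fun z ↦ vecCoord c V z j) y * covCoord g c Y y j k
        + vecCoord c V y j * pd l (fun z ↦ covCoord g c Y z j k) y) := by
  have hcoord := fun j ↦ differentiableAt_of_contDiffOn_target (hV.coord c j) hy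
  have hcov := fun j ↦ differentiableAt_of_contDiffOn_target (contDiffOn_covCoord g hY c j k) hy
  have hcovField : (fun z ↦ vecCoord c (covField g V Y) z k) =ᶠ[𝓝 y]
      fun z ↦ ∑ j, vecCoord c V z j * covCoord g c Y z j k := by
    filter_upwards [(isOpen_chartTarget c).mem_nhds hy] with z hz
    exact vecCoord_covField g V hY hz k
  rw [pd_congr hcovField, pd_sum fun j _ ↦ (hcoord j).fun_mul (hcov j)]
  exact Finset.sum_congr rfl fun j _ ↦ pd_mul (hcoord j) (hcov j) l

theorem sum_christoffel_mul_covCoord (c : M) (Y : VField n M) (y : Model n) (j : Fin n) :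
    ∑ i, ∑ l, christoffel g c i i l y * covCoord g c Y y j l =
      ∑ i, ∑ k, christoffel g c i i k y * pd j (fun z ↦ vecCoord c Y z k) y
        + ∑ i, ∑ k, (∑ l, christoffel g c i i l y * christoffel g c l j k y)
          * vecCoord c Y y k := by
  simp only [covCoord, mul_add, Finset.sum_add_distrib, Finset.sum_mul, Finset.mul_sum]
  congr 1
  refine Finset.sum_congr rfl fun i _ ↦ ?_
  rw [Finset.sum_comm]
  simp only [mul_assoc]

theorem sum_christoffel_mul_covCoord_comm (c : M) (Y : VField n M) (y : Model n) (j : Fin n) :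
    ∑ i, ∑ l, christoffel g c l i j y * covCoord g c Y y l i =
      ∑ i, ∑ k, christoffel g c i j k y * pd i (fun z ↦ vecCoord c Y z k) y
        + ∑ i, ∑ k, (∑ l, christoffel g c i j l y * christoffel g c l i k y)
          * vecCoord c Y y k := by
  rw [Finset.sum_comm]
  simp only [covCoord, mul_add, Finset.sum_add_distrib, Finset.sum_mul, Finset.mul_sum]
  congr 1
  · simp only [christoffel_symm g c _ _ j]
  · refine Finset.sum_congr rfl fun i _ ↦ ?_
    rw [Finset.sum_comm]
    refine Finset.sum_congr rfl fun k _ ↦ Finset.sum_congr rfl fun l _ ↦ ?_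
    rw [christoffel_symm g c i l j, christoffel_symm g c l i k, mul_assoc]

/- In invariant notation, `∇ᵢ∇ⱼYⁱ = ∇ⱼ∇ᵢYⁱ + R_{jk} Yᵏ`. -/
theorem contracted_ricci_identity {Y : VField n M} (hY : SmoothInCharts Y) {c : M} {y : Model n}
    (hy : y ∈ (extChartAt (𝓡 n) c).target) (j : Fin n) :
    ∑ i, pd i (fun z ↦ covCoord g c Y z j i) y
        + ∑ i, ∑ l, christoffel g c i i l y * covCoord g c Y y j l
        - ∑ i, ∑ l, christoffel g c l i j y * covCoord g c Y y l i =
      pd j (funRep c (divergence g Y)) y + ∑ k, ricciCoord g c y j k * vecCoord c Y y k := by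
  have hdivergence : funRep c (divergence g Y) =ᶠ[𝓝 y] fun z ↦ ∑ i, covCoord g c Y z i i := by
    filter_upwards [(isOpen_chartTarget c).mem_nhds hy] with z hz
    exact funRep_divergence g hY hz
  have hricci : ∑ k, ricciCoord g c y j k * vecCoord c Y y k =
      ∑ i, ∑ k, pd i (christoffel g c i j k) y * vecCoord c Y y k
        - ∑ i, ∑ k, pd j (christoffel g c i i k) y * vecCoord c Y y k
        + (∑ i, ∑ k, (∑ l, christoffel g c i i l y * christoffel g c l j k y) * vecCoord c Y y k
          - ∑ i, ∑ k, (∑ l, christoffel g c i j l y * christoffel g c l i k y)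
            * vecCoord c Y y k) := by
    simp only [ricciCoord, Matrix.of_apply, Finset.sum_mul (s := Finset.univ (α := Fin n))]
    rw [Finset.sum_comm]
    simp only [add_mul, sub_mul, Finset.sum_add_distrib, Finset.sum_sub_distrib, Finset.sum_mul]
  have hcomm : ∀ i, pd i (pd j fun z ↦ vecCoord c Y z i) y =
      pd j (pd i fun z ↦ vecCoord c Y z i) y := fun i ↦
    pd_comm (contDiffAt_of_contDiffOn_target (hY.coord c i) hy) i j
  rw [pd_congr hdivergence, pd_sum fun i _ ↦
    differentiableAt_of_contDiffOn_target (contDiffOn_covCoord g hY c i i) hy,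
    sum_christoffel_mul_covCoord, sum_christoffel_mul_covCoord_comm, hricci]
  simp only [pd_covCoord g hY hy, hcomm, Finset.sum_add_distrib]
  ring

theorem divergence_covField_eq_sum {V Y : VField n M} (hV : SmoothInCharts V)
    (hY : SmoothInCharts Y) (p : M) :
    divergence g (covField g V Y) p =
      ∑ j, ∑ i, pd i (fun z ↦ vecCoord p V z j) (base p) * covCoord g p Y (base p) j i
        + ∑ j, vecCoord p V (base p) j * (∑ i, pd i (fun z ↦ covCoord g p Y z j i) (base p)
          + ∑ i, ∑ l, christoffel g p i i l (base p) * covCoord g p Y (base p) j l) := by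
  have hy := base_mem_target (n := n) p
  change ∑ i, (pd i (fun z ↦ vecCoord p (covField g V Y) z i) (base p)
    + ∑ l, christoffel g p i i l (base p) * vecCoord p (covField g V Y) (base p) l) = _
  simp only [pd_vecCoord_covField g hV hY hy,
    vecCoord_covField g V hY hy, Finset.sum_add_distrib, mul_add, Finset.mul_sum]
  rw [add_assoc]
  congr 1
  · exact Finset.sum_comm
  · congr 1
    · exact Finset.sum_comm
    · rw [sum_sum_sum_reverse, Finset.sum_congr rfl fun j _ ↦ Finset.sum_comm]
      refine Finset.sum_congr rfl fun j _ ↦ Finset.sum_congr rfl fun i _ ↦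
        Finset.sum_congr rfl fun l _ ↦ ?_
      ring

theorem covTrace_eq_sum (V Y : VField n M) (p : M) :
    covTrace g V Y p =
      ∑ j, ∑ i, pd i (fun z ↦ vecCoord p V z j) (base p) * covCoord g p Y (base p) j i
        + ∑ j, vecCoord p V (base p) j *
          ∑ i, ∑ l, christoffel g p l i j (base p) * covCoord g p Y (base p) l i := by
  change ∑ i, ∑ j, (pd i (fun z ↦ vecCoord p V z j) (base p)
    + ∑ l, christoffel g p j i l (base p) * vecCoord p V (base p) l)
      * covCoord g p Y (base p) j i = _
  simp only [add_mul, Finset.sum_add_distrib, Finset.mul_sum,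
    Finset.sum_mul]
  congr 1
  · exact Finset.sum_comm
  · rw [Finset.sum_congr rfl fun i _ ↦ Finset.sum_comm, Finset.sum_comm]
    refine Finset.sum_congr rfl fun j _ ↦ Finset.sum_congr rfl fun i _ ↦
      Finset.sum_congr rfl fun l _ ↦ ?_
    ring

theorem divergence_covField {V Y : VField n M} (hV : SmoothInCharts V) (hY : SmoothInCharts Y)
    (p : M) :
    divergence g (covField g V Y) p = covTrace g V Y p + ricciApply g V Y p
      + fderiv ℝ (funRep p (divergence g Y)) (base p) (fieldRep p V (base p)) := by
  have hricci := contracted_ricci_identity g hY (base_mem_target (n := n) p)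
  have hricciApply : ricciApply g V Y p = ∑ j, vecCoord p V (base p) j *
      ∑ k, ricciCoord g p (base p) j k * vecCoord p Y (base p) k := by
    simp only [ricciApply, Finset.mul_sum]
    refine Finset.sum_congr rfl fun j _ ↦ Finset.sum_congr rfl fun k _ ↦ ?_
    change ricciCoord g p (base p) j k * vecCoord p V (base p) j * vecCoord p Y (base p) k = _
    ring
  have hderiv : fderiv ℝ (funRep p (divergence g Y)) (base p) (fieldRep p V (base p)) =
      ∑ j, vecCoord p V (base p) j * pd j (funRep p (divergence g Y)) (base p) :=
    fderiv_eq_sum_pd _ _ _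
  rw [divergence_covField_eq_sum g hV hY, covTrace_eq_sum, hricciApply, hderiv, add_assoc,
    add_assoc, add_right_inj, ← Finset.sum_add_distrib, ← Finset.sum_add_distrib]
  refine Finset.sum_congr rfl fun j _ ↦ ?_
  linear_combination vecCoord p V (base p) j * hricci j

end CommutationFormula

section Density

theorem trace_adjugate_mul {ι R : Type*} [Fintype ι] [DecidableEq ι] [CommRing R]
    (A B : Matrix ι ι R) :
    (A.adjugate * B).trace = ∑ σ : Equiv.Perm ι, ((Equiv.Perm.sign σ : ℤ) : R) *
      ∑ k, (∏ i ∈ Finset.univ.erase k, A (σ i) i) * B (σ k) k := by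
  have hcolumn : ∀ k, (A.adjugate * B) k k = (A.updateCol k fun l ↦ B l k).det := fun k ↦ by
    rw [← Matrix.cramer_apply, Matrix.cramer_eq_adjugate_mulVec]
    rfl
  simp only [Matrix.trace, Matrix.diag_apply, hcolumn, Matrix.det_apply', Finset.mul_sum]
  rw [Finset.sum_comm]
  refine Finset.sum_congr rfl fun σ _ ↦ Finset.sum_congr rfl fun k _ ↦ ?_
  rw [← Finset.mul_prod_erase _ _ (Finset.mem_univ k), Matrix.updateCol_self,
    mul_comm (B (σ k) k)]
  congr 2
  exact Finset.prod_congr rfl fun i hi ↦ by rw [Matrix.updateCol_ne (Finset.ne_of_mem_erase hi)]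

theorem fderiv_det {E ι : Type*} [NormedAddCommGroup E] [NormedSpace ℝ E] [Fintype ι]
    [DecidableEq ι] {A : E → Matrix ι ι ℝ} {y : E}
    (hA : ∀ i j, DifferentiableAt ℝ (fun z ↦ A z i j) y) (v : E) :
    fderiv ℝ (fun z ↦ (A z).det) y v =
      ((A y).adjugate * Matrix.of fun i j ↦ fderiv ℝ (fun z ↦ A z i j) y v).trace := by
  have hprod : ∀ σ : Equiv.Perm ι, HasFDerivAt (fun z ↦ ∏ i, A z (σ i) i)
      (∑ k, (∏ i ∈ Finset.univ.erase k, A y (σ i) i) • fderiv ℝ (fun z ↦ A z (σ k) k) y) y :=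
    fun σ ↦ HasFDerivAt.finsetProd fun k _ ↦ (hA (σ k) k).hasFDerivAt
  simp only [Matrix.det_apply']
  rw [(HasFDerivAt.fun_sum fun σ _ ↦ (hprod σ).const_mul _).fderiv, trace_adjugate_mul]
  simp [sum_apply]

variable {n : ℕ} {M : Type*} [TopologicalSpace M] [ChartedSpace (Model n) M]

/-- The Jacobian matrix of the change of coordinates from the chart at `c` to the chart at `d`. -/
def transitionJacobian (c d : M) (y : Model n) : Matrix (Fin n) (Fin n) ℝ :=
  Matrix.of fun k i ↦ fderiv ℝ (transition c d) y (EuclideanSpace.single i 1) k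

theorem transitionJacobian_det (c d : M) (y : Model n) :
    (transitionJacobian c d y).det = (fderiv ℝ (transition c d) y).det := by
  rw [ContinuousLinearMap.det, ← LinearMap.det_toMatrix (EuclideanSpace.basisFun (Fin n) ℝ).toBasis]
  rfl

variable [IsManifold (𝓡 n) ∞ M] (g : Metric n M)

/-- The Riemannian volume density `√(det g_{ij})` in the chart at `c`. -/
def volDensity (c : M) (y : Model n) : ℝ := √(metricCoord g c y).det

theorem volDensity_pos {c : M} {y : Model n} (hy : y ∈ (extChartAt (𝓡 n) c).target) :
    0 < volDensity g c y :=
  Real.sqrt_pos.2 (metricCoord_det_pos g hy)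

theorem contDiffOn_volDensity (c : M) :
    ContDiffOn ℝ ∞ (volDensity g c) (extChartAt (𝓡 n) c).target :=
  (contDiffOn_det (contDiffOn_metricCoord g c)).sqrt fun _ hy ↦ (metricCoord_det_pos g hy).ne'

theorem metricCoord_inv_symm (c : M) (y : Model n) (i j : Fin n) :
    (metricCoord g c y)⁻¹ i j = (metricCoord g c y)⁻¹ j i := by
  conv_lhs => rw [← metricCoord_transpose, ← Matrix.transpose_nonsing_inv, Matrix.transpose_apply]

theorem sum_christoffel (c : M) (y : Model n) (j : Fin n) :
    ∑ i, christoffel g c i i j y =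
      1 / 2 * ((metricCoord g c y)⁻¹ *
        Matrix.of fun i k ↦ pd j (fun z ↦ metricCoord g c z i k) y).trace := by
  have hmetric : ∀ i k, (fun z ↦ metricCoord g c z i k) = fun z ↦ metricCoord g c z k i :=
    fun i k ↦ funext fun z ↦ metricCoord_symm g c z i k
  have hcancel : ∑ i, ∑ l, (metricCoord g c y)⁻¹ i l * pd i (fun z ↦ metricCoord g c z j l) y =
      ∑ i, ∑ l, (metricCoord g c y)⁻¹ i l * pd l (fun z ↦ metricCoord g c z i j) y := by
    rw [Finset.sum_comm]
    exact Finset.sum_congr rfl fun l _ ↦ Finset.sum_congr rfl fun i _ ↦ by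
      rw [metricCoord_inv_symm, hmetric j l]
  simp only [christoffel, ← Finset.mul_sum, mul_sub, mul_add, Finset.sum_sub_distrib,
    Finset.sum_add_distrib, hcancel, Matrix.trace, Matrix.diag_apply, Matrix.mul_apply,
    Matrix.of_apply]
  rw [add_sub_cancel_left]
  exact congrArg _ (Finset.sum_congr rfl fun i _ ↦ Finset.sum_congr rfl fun l _ ↦ by rw [hmetric i])

theorem pd_volDensity {c : M} {y : Model n} (hy : y ∈ (extChartAt (𝓡 n) c).target) (j : Fin n) :
    pd j (volDensity g c) y = volDensity g c y * ∑ i, christoffel g c i i j y := by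
  have hpos := metricCoord_det_pos g hy
  have hsqrt : pd j (volDensity g c) y =
      1 / (2 * volDensity g c y) * pd j (fun z ↦ (metricCoord g c z).det) y :=
    congrArg (fun L : Model n →L[ℝ] ℝ ↦ L (EuclideanSpace.single j 1))
      ((differentiableAt_of_contDiffOn_target (contDiffOn_det (contDiffOn_metricCoord g c))
        hy).hasFDerivAt.sqrt hpos.ne').fderiv
  have hadjugate : (metricCoord g c y).adjugate =
      (metricCoord g c y).det • (metricCoord g c y)⁻¹ := by
    rw [Matrix.inv_def, smul_smul, Ring.mul_inverse_cancel _ (metricCoord_isUnit g hy), one_smul]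
  have hdet : pd j (fun z ↦ (metricCoord g c z).det) y =
      (metricCoord g c y).det * (2 * ∑ i, christoffel g c i i j y) := by
    rw [pd, fderiv_det fun i k ↦
      differentiableAt_of_contDiffOn_target (contDiffOn_metricCoord g c i k) hy, hadjugate,
      Matrix.smul_mul, Matrix.trace_smul, smul_eq_mul, sum_christoffel, ← mul_assoc 2,
      mul_one_div_cancel two_ne_zero, one_mul]
    rfl
  have hsq : (metricCoord g c y).det = volDensity g c y * volDensity g c y :=
    (Real.mul_self_sqrt hpos.le).symm
  rw [hsqrt, hdet, hsq]
  have := (volDensity_pos g hy).ne'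
  field_simp

theorem volDensity_mul_divergence {X : VField n M} (hX : SmoothInCharts X) {c : M} {y : Model n}
    (hy : y ∈ (extChartAt (𝓡 n) c).target) :
    volDensity g c y * funRep c (divergence g X) y =
      ∑ i, pd i (fun z ↦ volDensity g c z * vecCoord c X z i) y := by
  have hcoord := fun k ↦ differentiableAt_of_contDiffOn_target (hX.coord c k) hy
  have hdensity := differentiableAt_of_contDiffOn_target (contDiffOn_volDensity g c) hy
  simp only [funRep_divergence g hX hy, covCoord, Finset.sum_add_distrib, mul_add,
    fun i ↦ pd_mul hdensity (hcoord i) i, pd_volDensity g hy]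
  rw [add_comm, Finset.sum_comm, Finset.mul_sum, Finset.mul_sum]
  simp only [Finset.mul_sum, Finset.sum_mul, mul_assoc]

theorem metricCoord_transition {c d : M} {y : Model n} (hy : y ∈ overlap c d) :
    metricCoord g c y = (transitionJacobian c d y)ᵀ * metricCoord g d (transition c d y) *
      transitionJacobian c d y := by
  ext i j
  rw [← metricBil_single, metricBil_transition g hy, metricBil_apply]
  simp only [transitionJacobian, Matrix.mul_apply, Matrix.transpose_apply, Matrix.of_apply,
    Finset.sum_mul]
  rw [Finset.sum_comm]
  exact Finset.sum_congr rfl fun l _ ↦ Finset.sum_congr rfl fun k _ ↦ by ring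

theorem volDensity_transition {c d : M} {y : Model n} (hy : y ∈ overlap c d) :
    volDensity g c y = |(fderiv ℝ (transition c d) y).det| * volDensity g d (transition c d y) := by
  rw [volDensity, metricCoord_transition g hy, Matrix.det_mul, Matrix.det_mul,
    Matrix.det_transpose, transitionJacobian_det, ← Real.sqrt_sq_eq_abs, volDensity,
    ← Real.sqrt_mul (sq_nonneg _)]
  congr 1
  ring

end Density

section Volume

variable {n : ℕ} {M : Type*} [TopologicalSpace M] [ChartedSpace (Model n) M]

theorem measurableSet_chartTarget (c : M) : MeasurableSet (extChartAt (𝓡 n) c).target :=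
  (isOpen_chartTarget c).measurableSet

theorem image_transition {c d : M} {A : Set M} (hc : A ⊆ (extChartAt (𝓡 n) c).source)
    (hd : A ⊆ (extChartAt (𝓡 n) d).source) :
    transition c d '' ((extChartAt (𝓡 n) c).symm ⁻¹' A ∩ (extChartAt (𝓡 n) c).target) =
      (extChartAt (𝓡 n) d).symm ⁻¹' A ∩ (extChartAt (𝓡 n) d).target := by
  ext z
  constructor
  · rintro ⟨y, hy, rfl⟩
    have hoverlap : y ∈ overlap c d := ⟨hy.2, hd hy.1⟩
    refine ⟨?_, transition_mem_target hoverlap⟩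
    rw [mem_preimage, chart_symm_transition hoverlap]
    exact hy.1
  · intro hz
    have hoverlap : z ∈ overlap d c := ⟨hz.2, hc hz.1⟩
    refine ⟨transition d c z, ⟨?_, transition_mem_target hoverlap⟩, transition_transition hoverlap⟩
    rw [mem_preimage, chart_symm_transition hoverlap]
    exact hz.1

variable [MeasurableSpace M] [BorelSpace M]

theorem aemeasurable_chart_symm (c : M) (f : Model n → ENNReal) :
    AEMeasurable (extChartAt (𝓡 n) c).symm
      ((volume.restrict (extChartAt (𝓡 n) c).target).withDensity f) :=
  ((continuousOn_extChartAt_symm c).aemeasurable (measurableSet_chartTarget c)).mono_ac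
    (withDensity_absolutelyContinuous _ _)

theorem measurableSet_preimage_chart_symm (c : M) {A : Set M} (hA : MeasurableSet A) :
    MeasurableSet ((extChartAt (𝓡 n) c).symm ⁻¹' A ∩ (extChartAt (𝓡 n) c).target) := by
  have hsymm : Measurable ((extChartAt (𝓡 n) c).target.domRestrict (extChartAt (𝓡 n) c).symm) :=
    (continuousOn_extChartAt_symm c).domRestrict.measurable
  convert (measurableSet_chartTarget c).subtype_image (hsymm hA) using 1
  ext y
  simp [and_comm]

theorem measurableSet_chartSource (c : M) : MeasurableSet (extChartAt (𝓡 n) c).source :=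
  (isOpen_extChartAt_source c).measurableSet

variable [IsManifold (𝓡 n) ∞ M] (g : Metric n M)

theorem chartVolume_apply (c : M) {A : Set M} (hA : MeasurableSet A) :
    chartVolume g c A = ∫⁻ y in (extChartAt (𝓡 n) c).symm ⁻¹' A ∩ (extChartAt (𝓡 n) c).target,
      ENNReal.ofReal (volDensity g c y) := by
  rw [chartVolume, Measure.map_apply_of_aemeasurable (aemeasurable_chart_symm c _) hA,
    withDensity_apply', Measure.restrict_restrict' (measurableSet_chartTarget c)]
  rfl

theorem chartVolume_eq_of_subset {c d : M} {A : Set M} (hA : MeasurableSet A)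
    (hc : A ⊆ (extChartAt (𝓡 n) c).source) (hd : A ⊆ (extChartAt (𝓡 n) d).source) :
    chartVolume g c A = chartVolume g d A := by
  rw [chartVolume_apply g c hA, chartVolume_apply g d hA, ← image_transition hc hd]
  set S := (extChartAt (𝓡 n) c).symm ⁻¹' A ∩ (extChartAt (𝓡 n) c).target
  have hoverlap : S ⊆ overlap c d := fun y hy ↦ ⟨hy.2, hd hy.1⟩
  have hinj : InjOn (transition c d) S := fun y hy z hz hyz ↦ by
    rw [← transition_transition (hoverlap hy), hyz, transition_transition (hoverlap hz)]
  have hSmeas : MeasurableSet S := measurableSet_preimage_chart_symm c hA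
  rw [lintegral_image_eq_lintegral_abs_det_fderiv_mul volume hSmeas
    (fun y hy ↦ (hasFDerivAt_transition (hoverlap hy)).hasFDerivWithinAt) hinj]
  refine setLIntegral_congr_fun hSmeas fun y hy ↦ ?_
  rw [← ENNReal.ofReal_mul (abs_nonneg _), ← volDensity_transition g (hoverlap hy)]

theorem chartVolume_compl_source (c : M) :
    chartVolume g c (extChartAt (𝓡 n) c).sourceᶜ = 0 := by
  have hempty : (extChartAt (𝓡 n) c).symm ⁻¹' (extChartAt (𝓡 n) c).sourceᶜ ∩
      (extChartAt (𝓡 n) c).target = ∅ :=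
    eq_empty_of_forall_notMem fun y hy ↦ hy.1 ((extChartAt (𝓡 n) c).map_target hy.2)
  rw [chartVolume_apply g c (measurableSet_chartSource c).compl, hempty]
  simp

theorem chartVolume_inter_source (c : M) (A : Set M) :
    chartVolume g c (A ∩ (extChartAt (𝓡 n) c).source) = chartVolume g c A :=
  measure_inter_conull (measure_mono_null (fun _ hx ↦ hx) (chartVolume_compl_source g c))

theorem riemannianVolume_eq_chartVolume {c : M} {A : Set M} (hA : MeasurableSet A)
    (hc : A ⊆ (extChartAt (𝓡 n) c).source) : riemannianVolume g A = chartVolume g c A := by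
  refine le_antisymm ?_ (le_iSup (fun d ↦ chartVolume g d) c A)
  set s := (extChartAt (𝓡 n) c).source
  have hsmeas : MeasurableSet s := measurableSet_chartSource c
  have hle : riemannianVolume g ≤ chartVolume g c + (riemannianVolume g).restrict sᶜ := by
    refine iSup_le fun d ↦ Measure.le_iff.2 fun B hB ↦ ?_
    rw [Measure.add_apply, Measure.restrict_apply hB, ← measure_inter_add_sdiff B hsmeas]
    refine add_le_add ?_ (le_iSup (fun d ↦ chartVolume g d) d _)
    rw [← chartVolume_inter_source, ← chartVolume_eq_of_subset g (c := c)
      ((hB.inter hsmeas).inter (measurableSet_chartSource d)) (fun x hx ↦ hx.1.2) fun x hx ↦ hx.2]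
    exact measure_mono fun x hx ↦ hx.1.1
  have hdisjoint : A ∩ sᶜ = ∅ := (disjoint_compl_right_iff_subset.2 hc).inter_eq
  simpa [Measure.restrict_apply hA, hdisjoint] using hle A

theorem riemannianVolume_restrict_source (c : M) :
    (riemannianVolume g).restrict (extChartAt (𝓡 n) c).source = chartVolume g c := by
  ext A hA
  rw [Measure.restrict_apply hA, riemannianVolume_eq_chartVolume g
    (hA.inter (measurableSet_chartSource c)) inter_subset_right, chartVolume_inter_source]

instance instIsLocallyFiniteMeasureRiemannianVolume :
    IsLocallyFiniteMeasure (riemannianVolume g) := by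
  refine ⟨fun c ↦ ?_⟩
  obtain ⟨r, hr, hball⟩ := Metric.nhds_basis_closedBall.mem_iff.1
    ((isOpen_chartTarget c).mem_nhds (mem_extChartAt_target (I := 𝓡 n) c))
  set U := (extChartAt (𝓡 n) c).source ∩
    extChartAt (𝓡 n) c ⁻¹' Metric.ball (extChartAt (𝓡 n) c c) r
  have hUopen : IsOpen U := isOpen_extChartAt_preimage' c Metric.isOpen_ball
  have hdensity : IntegrableOn (volDensity g c) (Metric.closedBall (extChartAt (𝓡 n) c c) r) :=
    ((contDiffOn_volDensity g c).continuousOn.mono hball).integrableOn_compact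
      (isCompact_closedBall _ _)
  refine ⟨U, hUopen.mem_nhds ⟨mem_extChartAt_source c, by simpa using hr⟩, ?_⟩
  rw [riemannianVolume_eq_chartVolume g hUopen.measurableSet inter_subset_left,
    chartVolume_apply g c hUopen.measurableSet]
  refine (lintegral_mono_set fun y hy ↦ Metric.ball_subset_closedBall ?_).trans_lt
    hdensity.lintegral_lt_top
  simpa only [mem_preimage, (extChartAt (𝓡 n) c).right_inv hy.2] using hy.1.2

instance instIsOpenPosMeasureRiemannianVolume :
    (riemannianVolume g).IsOpenPosMeasure := by
  refine ⟨fun U hU ⟨p, hp⟩ hzero ↦ ?_⟩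
  have hchart : chartVolume g p U = 0 :=
    le_antisymm ((le_iSup (fun d ↦ chartVolume g d) p U).trans hzero.le) zero_le
  rw [chartVolume_apply g p hU.measurableSet] at hchart
  set S := (extChartAt (𝓡 n) p).symm ⁻¹' U ∩ (extChartAt (𝓡 n) p).target with hS
  have hSopen : IsOpen S := by
    rw [hS, inter_comm]
    exact (continuousOn_extChartAt_symm p).isOpen_inter_preimage (isOpen_chartTarget p) hU
  have hdensity : AEMeasurable (fun y ↦ ENNReal.ofReal (volDensity g p y)) (volume.restrict S) :=
    (((contDiffOn_volDensity g p).continuousOn.mono inter_subset_right).aemeasurable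
      hSopen.measurableSet).ennreal_ofReal
  rw [lintegral_eq_zero_iff' hdensity, EventuallyEq, ae_restrict_iff' hSopen.measurableSet]
    at hchart
  have hSnull : volume S = 0 := by
    refine measure_mono_null (fun y hy ↦ ?_) hchart
    exact fun hvanish ↦ (ENNReal.ofReal_pos.2 (volDensity_pos g hy.2)).ne' (hvanish hy)
  have hSne : S.Nonempty := ⟨base p, by rwa [mem_preimage, chart_symm_base], base_mem_target p⟩
  exact (hSopen.measure_pos volume hSne).ne' hSnull

theorem integral_eq_integral_chart {c : M} {f : M → ℝ} (hf : Continuous f)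
    (hzero : ∀ p ∉ (extChartAt (𝓡 n) c).source, f p = 0) :
    ∫ p, f p ∂(riemannianVolume g) =
      ∫ y in (extChartAt (𝓡 n) c).target, volDensity g c y * funRep c f y := by
  have hdensity : AEMeasurable (fun y ↦ ENNReal.ofReal √(metricCoord g c y).det)
      (volume.restrict (extChartAt (𝓡 n) c).target) :=
    ((contDiffOn_volDensity g c).continuousOn.aemeasurable
      (measurableSet_chartTarget c)).ennreal_ofReal
  rw [← setIntegral_eq_integral_of_forall_compl_eq_zero hzero, riemannianVolume_restrict_source,
    chartVolume, integral_map (aemeasurable_chart_symm c _) hf.aestronglyMeasurable,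
    integral_withDensity_eq_integral_toReal_smul₀ hdensity
      (Eventually.of_forall fun y ↦ ENNReal.ofReal_lt_top)]
  refine setIntegral_congr_fun (measurableSet_chartTarget c) fun y _ ↦ ?_
  simp only [smul_eq_mul, funRep]
  rw [ENNReal.toReal_ofReal (Real.sqrt_nonneg _)]
  rfl

end Volume

section DivergenceTheorem

theorem contDiff_indicator {E F : Type*} [NormedAddCommGroup E] [NormedSpace ℝ E]
    [NormedAddCommGroup F] [NormedSpace ℝ F] {k : WithTop ℕ∞} {u : E → F} {T K : Set E}
    (hT : IsOpen T) (hK : IsClosed K) (hKT : K ⊆ T) (hu : ContDiffOn ℝ k u T)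
    (hzero : ∀ y ∈ T \ K, u y = 0) : ContDiff ℝ k (T.indicator u) := by
  refine contDiff_iff_contDiffAt.2 fun y ↦ ?_
  by_cases hy : y ∈ T
  · refine (hu.contDiffAt (hT.mem_nhds hy)).congr_of_eventuallyEq ?_
    filter_upwards [hT.mem_nhds hy] with z hz using indicator_of_mem hz u
  · refine (contDiffAt_const (c := 0)).congr_of_eventuallyEq ?_
    filter_upwards [hK.isOpen_compl.mem_nhds fun hyK ↦ hy (hKT hyK)] with z hz
    exact indicator_apply_eq_zero.2 fun hzT ↦ hzero z ⟨hzT, hz⟩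

theorem integral_pd_eq_zero {n : ℕ} {u : Model n → ℝ} (hu : ContDiff ℝ 1 u)
    (hsupp : HasCompactSupport u) (i : Fin n) :
    Integrable (pd i u) ∧ ∫ y, pd i u y = 0 := by
  have hpd : Integrable (pd i u) :=
    ((hu.continuous_fderiv (by simp)).clm_apply continuous_const).integrable_of_hasCompactSupport
      (hsupp.fderiv_apply ℝ _)
  refine ⟨hpd, ?_⟩
  simpa using! integral_mul_fderiv_eq_neg_fderiv_mul_of_integrable (μ := volume)
    (f := fun _ : Model n ↦ (1 : ℝ)) (g := u) (v := EuclideanSpace.single i 1) (by simp)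
    (by simpa using! hpd) (by simpa using hu.continuous.integrable_of_hasCompactSupport hsupp)
    (fun x _ ↦ differentiableAt_const _) (fun x _ ↦ hu.differentiable (by simp) x)

theorem setIntegral_pd_eq_zero {n : ℕ} {u : Model n → ℝ} {T K : Set (Model n)} (hT : IsOpen T)
    (hK : IsCompact K) (hKT : K ⊆ T) (hu : ContDiffOn ℝ 1 u T) (hzero : ∀ y ∈ T \ K, u y = 0)
    (i : Fin n) : IntegrableOn (pd i u) T ∧ ∫ y in T, pd i u y = 0 := by
  have hvanish : ∀ y ∉ K, T.indicator u y = 0 := fun y hy ↦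
    indicator_apply_eq_zero.2 fun hyT ↦ hzero y ⟨hyT, hy⟩
  obtain ⟨hint, hintegral⟩ := integral_pd_eq_zero
    (contDiff_indicator hT hK.isClosed hKT hu hzero) (HasCompactSupport.intro hK hvanish) i
  have hpd : EqOn (pd i (T.indicator u)) (pd i u) T := fun y hy ↦ by
    refine pd_congr ?_ i
    filter_upwards [hT.mem_nhds hy] with z hz using indicator_of_mem hz u
  refine ⟨hint.integrableOn.congr_fun hpd hT.measurableSet, ?_⟩
  rw [← setIntegral_congr_fun hT.measurableSet hpd, ← hintegral]
  refine setIntegral_eq_integral_of_forall_compl_eq_zero fun y hy ↦ ?_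
  have hnear : T.indicator u =ᶠ[𝓝 y] fun _ ↦ 0 := by
    filter_upwards [hK.isClosed.isOpen_compl.mem_nhds fun hyK ↦ hy (hKT hyK)] with z hz
    exact hvanish z hz
  rw [pd_congr hnear]
  simp [pd]

variable {n : ℕ} {M : Type*} [TopologicalSpace M] [ChartedSpace (Model n) M]

theorem fieldRep_eq_zero {c : M} {X : VField n M} {y : Model n}
    (hX : X ((extChartAt (𝓡 n) c).symm y) = 0) : fieldRep c X y = 0 := by
  rw [fieldRep, hX]
  exact map_zero (mvfderiv (𝓡 n) (extChartAt (𝓡 n) c) _)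

variable [IsManifold (𝓡 n) ∞ M] (g : Metric n M)

theorem divergence_eq_zero_of_notMem {X : VField n M} {K : Set M} (hK : IsClosed K)
    (hX : ∀ p ∉ K, X p = 0) {p : M} (hp : p ∉ K) : divergence g X p = 0 := by
  have hvanish : ∀ᶠ z in 𝓝 (base p : Model n), fieldRep p X z = 0 := by
    filter_upwards [((continuousOn_extChartAt_symm p).isOpen_inter_preimage (isOpen_chartTarget p)
      hK.isOpen_compl).mem_nhds ⟨base_mem_target p, by rwa [mem_preimage, chart_symm_base]⟩]
      with z hz using fieldRep_eq_zero (hX _ hz.2)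
  have hcoord : ∀ j, vecCoord p X (base p) j = 0 := fun j ↦
    congrArg (fun w : Model n ↦ w j) hvanish.self_of_nhds
  have hpd : ∀ i, pd i (fun z ↦ vecCoord p X z i) (base p) = 0 := fun i ↦ by
    have hcoord : (fun z ↦ vecCoord p X z i) =ᶠ[𝓝 (base p)] fun _ ↦ 0 := by
      filter_upwards [hvanish] with z hz using congrArg (fun w : Model n ↦ w i) hz
    rw [pd_congr hcoord]
    simp [pd]
  simp [divergence, covCoord, hcoord, hpd]

variable [MeasurableSpace M] [BorelSpace M]

theorem integral_divergence_eq_zero_of_subset_source [T2Space M] {X : VField n M}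
    (hX : SmoothInCharts X) {c : M} {K : Set M} (hK : IsCompact K)
    (hKc : K ⊆ (extChartAt (𝓡 n) c).source) (hXK : ∀ p ∉ K, X p = 0) :
    ∫ p, divergence g X p ∂(riemannianVolume g) = 0 := by
  have hsmooth : ∀ i, ContDiffOn ℝ 1 (fun y ↦ volDensity g c y * vecCoord c X y i)
      (extChartAt (𝓡 n) c).target := fun i ↦
    ((contDiffOn_volDensity g c).mul (hX.coord c i)).of_le (by simp)
  have hzero : ∀ i, ∀ y ∈ (extChartAt (𝓡 n) c).target \ extChartAt (𝓡 n) c '' K,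
      volDensity g c y * vecCoord c X y i = 0 := fun i y hy ↦ by
    have hcoord : vecCoord c X y i = 0 := congrArg (fun w : Model n ↦ w i) <|
      fieldRep_eq_zero (hXK _ fun h ↦ hy.2 ⟨_, h, (extChartAt (𝓡 n) c).right_inv hy.1⟩)
    rw [hcoord, mul_zero]
  have hflux := fun i ↦ setIntegral_pd_eq_zero (isOpen_chartTarget c)
    (hK.image_of_continuousOn ((continuousOn_extChartAt (I := 𝓡 n) c).mono hKc))
    ((image_mono hKc).trans (extChartAt (𝓡 n) c).image_source_eq_target.subset)
    (hsmooth i) (hzero i) i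
  rw [integral_eq_integral_chart g (continuous_divergence g hX) (c := c) fun p hp ↦
      divergence_eq_zero_of_notMem g hK.isClosed hXK fun h ↦ hp (hKc h),
    setIntegral_congr_fun (measurableSet_chartTarget c) fun y hy ↦
      volDensity_mul_divergence g hX hy,
    integral_finsetSum _ fun i _ ↦ (hflux i).1]
  exact Finset.sum_eq_zero fun i _ ↦ (hflux i).2

variable [CompactSpace M]

theorem integrable_of_continuous {f : M → ℝ} (hf : Continuous f) :
    Integrable f (riemannianVolume g) :=
  hf.integrable_of_hasCompactSupport (HasCompactSupport.of_compactSpace f)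

theorem integral_divergence_eq_zero [T2Space M] {X : VField n M} (hX : SmoothInCharts X) :
    ∫ p, divergence g X p ∂(riemannianVolume g) = 0 := by
  obtain ⟨t, ht⟩ := isCompact_univ.elim_finite_subcover
    (fun c : M ↦ (extChartAt (𝓡 n) c).source) (fun c ↦ isOpen_extChartAt_source c)
    (fun p _ ↦ mem_iUnion.2 ⟨p, mem_extChartAt_source p⟩)
  obtain ⟨ρ, hρ⟩ := SmoothPartitionOfUnity.exists_isSubordinate (𝓡 n) isClosed_univ
    (fun c : t ↦ (extChartAt (𝓡 n) (c : M)).source) (fun c ↦ isOpen_extChartAt_source _)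
    (fun p hp ↦ by simpa using ht hp)
  have hsmooth : ∀ c : t, SmoothInCharts fun p ↦ ρ c p • X p := fun c ↦
    SmoothInCharts.smul (smoothFunInCharts_of_contMDiff (ρ c).contMDiff) hX
  have hsum : X = fun p ↦ ∑ c : t, ρ c p • X p := by
    funext p
    rw [← Finset.sum_smul, ← finsum_eq_sum_of_fintype, ρ.sum_eq_one (mem_univ p), one_smul]
  rw [hsum]
  simp only [divergence_sum g Finset.univ fun c _ ↦ hsmooth c]
  rw [integral_finsetSum _ fun c _ ↦
    integrable_of_continuous g (continuous_divergence g (hsmooth c))]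
  refine Finset.sum_eq_zero fun c _ ↦ integral_divergence_eq_zero_of_subset_source g (hsmooth c)
    (isClosed_tsupport (ρ c)).isCompact (hρ c) fun p hp ↦ ?_
  rw [image_eq_zero_of_notMem_tsupport hp, zero_smul]

theorem eq_zero_of_integral_nonpos {f : M → ℝ} (hf : Continuous f) (hnonneg : ∀ p, 0 ≤ f p)
    (hint : ∫ p, f p ∂(riemannianVolume g) ≤ 0) (p : M) : f p = 0 := by
  have hae := (integral_eq_zero_iff_of_nonneg hnonneg (integrable_of_continuous g hf)).1
    (le_antisymm hint (integral_nonneg hnonneg))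
  exact congrFun ((Continuous.ae_eq_iff_eq (riemannianVolume g) hf continuous_zero).1 hae) p

end DivergenceTheorem

section TensorInner

variable {n : ℕ} {M : Type*} [TopologicalSpace M] [ChartedSpace (Model n) M]
  [IsManifold (𝓡 n) ∞ M] (g : Metric n M) (p : M)

open Matrix

theorem metricAt_posDef : (metricAt g p).PosDef :=
  metricCoord_posDef g (base_mem_target p)

theorem metricAt_isUnit : IsUnit (metricAt g p).det :=
  metricCoord_isUnit g (base_mem_target p)

theorem metricAt_transpose : (metricAt g p)ᵀ = metricAt g p :=
  metricCoord_transpose g p (base p)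

theorem metricAt_inv_transpose : ((metricAt g p)⁻¹)ᵀ = (metricAt g p)⁻¹ := by
  rw [transpose_nonsing_inv, metricAt_transpose]

theorem tensorInner_eq_trace (S T : Matrix (Fin n) (Fin n) ℝ) :
    tensorInner g p S T = (Sᵀ * (metricAt g p)⁻¹ * T * (metricAt g p)⁻¹).trace := by
  have hsymm : ∀ j l, (metricAt g p)⁻¹ j l = (metricAt g p)⁻¹ l j := fun j l ↦
    metricCoord_inv_symm g p (base p) j l
  simp only [tensorInner, trace, diag_apply, mul_apply, transpose_apply, Finset.sum_mul]
  rw [Finset.sum_comm]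
  refine Finset.sum_congr rfl fun j _ ↦ ?_
  rw [Finset.sum_comm_cycle]
  refine Finset.sum_congr rfl fun l _ ↦ ?_
  rw [Finset.sum_comm]
  refine Finset.sum_congr rfl fun k _ ↦ Finset.sum_congr rfl fun i _ ↦ ?_
  rw [hsymm j l]
  ring

/-- The metric induced by `g` on covariant 2-tensors at `p`, as a bilinear form. -/
def tensorForm : LinearMap.BilinForm ℝ (Matrix (Fin n) (Fin n) ℝ) :=
  LinearMap.mk₂ ℝ (tensorInner g p)
    (fun S S' T ↦ by simp [tensorInner_eq_trace, Matrix.add_mul])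
    (fun a S T ↦ by simp [tensorInner_eq_trace])
    (fun S T T' ↦ by simp [tensorInner_eq_trace, Matrix.mul_add, Matrix.add_mul])
    (fun a S T ↦ by simp [tensorInner_eq_trace])

theorem tensorForm_apply (S T : Matrix (Fin n) (Fin n) ℝ) :
    tensorForm g p S T = tensorInner g p S T :=
  rfl

theorem tensorInner_transpose (S T : Matrix (Fin n) (Fin n) ℝ) :
    tensorInner g p Sᵀ Tᵀ = tensorInner g p S T := by
  rw [tensorInner_eq_trace, tensorInner_eq_trace, ← trace_transpose]
  simp only [transpose_mul, transpose_transpose, metricAt_inv_transpose]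
  rw [← Matrix.mul_assoc, ← Matrix.mul_assoc, trace_mul_comm]
  simp only [Matrix.mul_assoc]

theorem tensorInner_comm (S T : Matrix (Fin n) (Fin n) ℝ) :
    tensorInner g p S T = tensorInner g p T S := by
  rw [tensorInner_eq_trace, tensorInner_eq_trace, ← trace_transpose]
  simp only [transpose_mul, transpose_transpose, metricAt_inv_transpose]
  rw [trace_mul_comm]
  simp only [Matrix.mul_assoc]

open scoped MatrixOrder in
theorem tensorInner_self_nonneg (S : Matrix (Fin n) (Fin n) ℝ) : 0 ≤ tensorInner g p S S := by
  obtain ⟨Q, hQ⟩ := CStarAlgebra.nonneg_iff_eq_star_mul_self.1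
    (metricAt_posDef g p).inv.posSemidef.nonneg
  have hsq : tensorInner g p S S = ((Q * S * Qᴴ)ᴴ * (Q * S * Qᴴ)).trace := by
    rw [tensorInner_eq_trace, hQ]
    simp only [star_eq_conjTranspose, conjTranspose_eq_transpose_of_trivial, transpose_mul,
      transpose_transpose]
    rw [← Matrix.mul_assoc, trace_mul_comm]
    simp only [Matrix.mul_assoc]
  exact hsq ▸ (posSemidef_conjTranspose_mul_self _).trace_nonneg

theorem tensorInner_metricAt (S : Matrix (Fin n) (Fin n) ℝ) :
    tensorInner g p S (metricAt g p) = (S * (metricAt g p)⁻¹).trace := by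
  rw [tensorInner_eq_trace, nonsing_inv_mul_cancel_right _ _ (metricAt_isUnit g p),
    ← trace_transpose, transpose_mul, transpose_transpose, metricAt_inv_transpose, trace_mul_comm]

theorem tensorInner_metricAt_self : tensorInner g p (metricAt g p) (metricAt g p) = n := by
  rw [tensorInner_metricAt, mul_nonsing_inv _ (metricAt_isUnit g p), trace_one, Fintype.card_fin]

theorem sq_tensorInner_metricAt_le (S : Matrix (Fin n) (Fin n) ℝ) :
    tensorInner g p S (metricAt g p) ^ 2 ≤ n * tensorInner g p S S := by
  have hcauchy := (tensorForm g p).apply_mul_apply_le_of_forall_zero_le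
    (tensorInner_self_nonneg g p) S (metricAt g p)
  rwa [tensorForm_apply, tensorForm_apply, tensorForm_apply, tensorForm_apply,
    tensorInner_comm g p (metricAt g p) S, tensorInner_metricAt_self, ← sq, mul_comm] at hcauchy

theorem tensorInner_flat (S : Matrix (Fin n) (Fin n) ℝ) (X : VField n M) :
    tensorInner g p S (vecMulVec (flat g X p) (flat g X p)) = vecAt X p ⬝ᵥ S *ᵥ vecAt X p := by
  have hraise : (metricAt g p)⁻¹ * vecMulVec (flat g X p) (flat g X p) * (metricAt g p)⁻¹ =
      vecMulVec (vecAt X p) (vecAt X p) := by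
    rw [mul_vecMulVec, vecMulVec_mul, flat, mulVec_mulVec, nonsing_inv_mul _ (metricAt_isUnit g p),
      one_mulVec, ← vecMul_transpose, metricAt_transpose, vecMul_vecMul,
      mul_nonsing_inv _ (metricAt_isUnit g p), vecMul_one]
  rw [tensorInner_eq_trace, Matrix.mul_assoc Sᵀ, Matrix.mul_assoc Sᵀ, hraise, mul_vecMulVec,
    trace_vecMulVec, mulVec_transpose, dotProduct_mulVec]

theorem metricBil_eq_dotProduct (u w : Model n) :
    metricBil g p (base p) u w = u.ofLp ⬝ᵥ metricAt g p *ᵥ w.ofLp := by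
  rw [metricBil_apply]
  simp only [dotProduct, mulVec, Finset.mul_sum, metricAt]
  exact Finset.sum_congr rfl fun i _ ↦ Finset.sum_congr rfl fun j _ ↦ by ring

theorem normSq_eq (X : VField n M) : normSq g X p = vecAt X p ⬝ᵥ flat g X p := by
  rw [normSq, inner_eq_chart g X X (mem_extChartAt_source p)]
  exact metricBil_eq_dotProduct g p _ _

theorem tensorInner_metricAt_flat (X : VField n M) :
    tensorInner g p (metricAt g p) (vecMulVec (flat g X p) (flat g X p)) = normSq g X p := by
  rw [tensorInner_flat, normSq_eq, flat]

theorem tensorInner_flat_self (X : VField n M) :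
    tensorInner g p (vecMulVec (flat g X p) (flat g X p)) (vecMulVec (flat g X p) (flat g X p)) =
      normSq g X p ^ 2 := by
  rw [tensorInner_flat, vecMulVec_mulVec, dotProduct_smul, normSq_eq,
    dotProduct_comm (flat g X p), sq]
  rfl

end TensorInner

section CovariantTensor

variable {n : ℕ} {M : Type*} [TopologicalSpace M] [ChartedSpace (Model n) M]
  [IsManifold (𝓡 n) ∞ M] (g : Metric n M)

open Matrix

/-- The covariant 2-tensor `∇X♭` at `p`, with components `∇ᵢ X_l = ∇ᵢ Xᵏ g_{kl}`. -/
def covTensor (X : VField n M) (p : M) : Matrix (Fin n) (Fin n) ℝ :=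
  Matrix.of (covCoord g p X (base p)) * metricAt g p

theorem covTensor_add {X Y : VField n M} (hX : SmoothInCharts X) (hY : SmoothInCharts Y) (p : M) :
    covTensor g (fun q ↦ X q + Y q) p = covTensor g X p + covTensor g Y p := by
  rw [covTensor, covTensor, covTensor, ← Matrix.add_mul]
  congr 1
  ext i k
  exact covCoord_add g hX hY (base_mem_target p) i k

theorem tensorInner_covTensor_metricAt (X : VField n M) (p : M) :
    tensorInner g p (covTensor g X p) (metricAt g p) = divergence g X p := by
  rw [tensorInner_metricAt, covTensor, mul_nonsing_inv_cancel_right _ _ (metricAt_isUnit g p)]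
  rfl

theorem tensorInner_covTensor_transpose (X Y : VField n M) (p : M) :
    tensorInner g p (covTensor g X p)ᵀ (covTensor g Y p) = covTrace g X Y p := by
  rw [tensorInner_eq_trace, transpose_transpose, Matrix.mul_assoc, covTensor, covTensor,
    mul_nonsing_inv_cancel_right _ _ (metricAt_isUnit g p),
    mul_nonsing_inv_cancel_right _ _ (metricAt_isUnit g p)]
  rfl

theorem lieMetric_eq {X : VField n M} (hX : SmoothInCharts X) (p : M) :
    lieMetric g X p = covTensor g X p + (covTensor g X p)ᵀ := by
  ext i j
  rw [lieMetric, lieCoord_eq g hX (base_mem_target p)]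
  rfl

theorem tensorInner_lieMetric {X : VField n M} (hX : SmoothInCharts X) {p : M}
    {S : Matrix (Fin n) (Fin n) ℝ} (hS : Sᵀ = S) :
    tensorInner g p S (lieMetric g X p) = 2 * tensorInner g p S (covTensor g X p) := by
  have htranspose := tensorInner_transpose g p S (covTensor g X p)
  rw [hS] at htranspose
  rw [lieMetric_eq g hX, ← tensorForm_apply, map_add, tensorForm_apply, tensorForm_apply,
    htranspose, two_mul]

theorem hess_eq {h : M → ℝ} (hh : ContMDiff (𝓡 n) 𝓘(ℝ, ℝ) ∞ h) (p : M) :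
    hess g h p = covTensor g (grad g h) p := by
  ext i j
  rw [hess, hessCoord_eq g hh (base_mem_target p)]
  rfl

theorem hess_transpose {h : M → ℝ} (hh : ContMDiff (𝓡 n) 𝓘(ℝ, ℝ) ∞ h) (p : M) :
    (hess g h p)ᵀ = hess g h p := by
  ext i j
  exact hessCoord_symm g hh (base_mem_target p) j i

theorem diffAt_eq {h : M → ℝ} (hh : ContMDiff (𝓡 n) 𝓘(ℝ, ℝ) ∞ h) (p : M) :
    diffAt h p = flat g (grad g h) p :=
  diffCoord_eq g hh (base_mem_target p)

theorem tensorInner_hess_self {h : M → ℝ} (hh : ContMDiff (𝓡 n) 𝓘(ℝ, ℝ) ∞ h) (p : M) :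
    tensorInner g p (hess g h p) (hess g h p) = covTrace g (grad g h) (grad g h) p := by
  rw [← tensorInner_covTensor_transpose, ← hess_eq g hh, hess_transpose g hh]

theorem divergence_normSq_smul_eq {X : VField n M} (hX : SmoothInCharts X) (p : M) :
    divergence g (fun q ↦ normSq g X q • X q) p =
      2 * tensorInner g p (covTensor g X p) (vecMulVec (flat g X p) (flat g X p))
        + normSq g X p * divergence g X p := by
  have hcov : (covLin g p X (base p) (fieldRep p X (base p))).ofLp =
      vecAt X p ᵥ* Matrix.of (covCoord g p X (base p)) := by
    ext k
    rw [covLin_apply]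
    rfl
  rw [divergence_normSq_smul g hX, metricBil_eq_dotProduct, hcov, tensorInner_flat, covTensor,
    ← mulVec_mulVec, dotProduct_mulVec (vecAt X p)]
  rfl

end CovariantTensor

section Soliton

variable {n : ℕ} {M : Type*} [TopologicalSpace M] [ChartedSpace (Model n) M]
  [IsManifold (𝓡 n) ∞ M] (g : Metric n M)

open Matrix

/-- The equation of a quasi `k`-Yamabe soliton with an arbitrary function `s` in place of
`σ_k - λ`. -/
structure IsQuasiSoliton (m : ℝ) (s : M → ℝ) (X : VField n M) : Prop where
  m_ne_zero : m ≠ 0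
  smooth : IsSmoothField X
  equation : ∀ p, (1 / 2 : ℝ) • lieMetric g X p - (1 / m) • vecMulVec (flat g X p) (flat g X p)
    = s p • metricAt g p

/-- The tensor `∇²h - (1/m) dh ⊗ dh - s g` at `p`, which vanishes when `∇h` is a quasi soliton. -/
def solitonTensor (m : ℝ) (s h : M → ℝ) (p : M) : Matrix (Fin n) (Fin n) ℝ :=
  hess g h p - (1 / m) • vecMulVec (diffAt h p) (diffAt h p) - s p • metricAt g p

/-- The integrand of the characterization of gradient solitons, with `s` in place of
`σ_k - λ`. -/
def gradientIntegrand (m : ℝ) (s : M → ℝ) (X : VField n M) (h : M → ℝ) (Y : VField n M)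
    (p : M) : ℝ :=
  ricciApply g (grad g h) Y p
    + (1 / m) * tensorInner g p (hess g h p) (vecMulVec (flat g X p) (flat g X p))
    - (2 / m) * tensorInner g p (hess g h p) (vecMulVec (diffAt h p) (diffAt h p))
    + (1 / m ^ 2) * tensorInner g p (vecMulVec (diffAt h p) (diffAt h p))
        (vecMulVec (diffAt h p) (diffAt h p))
    + (n / (2 * m)) * s p * normSq g X p
    + (2 / m) * s p * normSq g (grad g h) p
    + (3 / (2 * m ^ 2)) * (normSq g X p) ^ 2

theorem continuous_normSq {X : VField n M} (hX : SmoothInCharts X) : Continuous (normSq g X) :=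
  (smoothFunInCharts_inner g hX hX).continuous

theorem SmoothInCharts.normSq_smul {X : VField n M} (hX : SmoothInCharts X) :
    SmoothInCharts fun q ↦ normSq g X q • X q :=
  SmoothInCharts.smul (f := normSq g X) (smoothFunInCharts_inner g hX hX) hX

section Potential

variable {h : M → ℝ} (hh : ContMDiff (𝓡 n) 𝓘(ℝ, ℝ) ∞ h) (m : ℝ) (s : M → ℝ)
include hh

theorem tensorInner_solitonTensor_metricAt (p : M) :
    tensorInner g p (solitonTensor g m s h p) (metricAt g p) =
      divergence g (grad g h) p - (1 / m) * normSq g (grad g h) p - n * s p := by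
  have hdiffTrace : tensorInner g p (vecMulVec (diffAt h p) (diffAt h p)) (metricAt g p) =
      normSq g (grad g h) p := by
    rw [diffAt_eq g hh, tensorInner_comm, tensorInner_metricAt_flat]
  simp only [solitonTensor, ← tensorForm_apply, map_sub, map_smul, LinearMap.sub_apply,
    LinearMap.smul_apply, smul_eq_mul]
  simp only [tensorForm_apply, hess_eq g hh, tensorInner_covTensor_metricAt, hdiffTrace,
    tensorInner_metricAt_self, mul_comm (s p)]

theorem tensorInner_solitonTensor_self (p : M) :
    tensorInner g p (solitonTensor g m s h p) (solitonTensor g m s h p) =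
      tensorInner g p (hess g h p) (hess g h p) + (1 / m ^ 2) * normSq g (grad g h) p ^ 2
        + n * s p ^ 2
        - (2 / m) * tensorInner g p (hess g h p) (vecMulVec (diffAt h p) (diffAt h p))
        - 2 * s p * divergence g (grad g h) p + (2 / m) * s p * normSq g (grad g h) p := by
  have htrace : tensorInner g p (hess g h p) (metricAt g p) = divergence g (grad g h) p := by
    rw [hess_eq g hh, tensorInner_covTensor_metricAt]
  have hdiffTrace : tensorInner g p (metricAt g p) (vecMulVec (diffAt h p) (diffAt h p)) =
      normSq g (grad g h) p := by
    rw [diffAt_eq g hh, tensorInner_metricAt_flat]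
  have hdiffSq : tensorInner g p (vecMulVec (diffAt h p) (diffAt h p))
      (vecMulVec (diffAt h p) (diffAt h p)) = normSq g (grad g h) p ^ 2 := by
    rw [diffAt_eq g hh, tensorInner_flat_self]
  simp only [solitonTensor, ← tensorForm_apply, map_sub, map_smul, LinearMap.sub_apply,
    LinearMap.smul_apply, smul_eq_mul]
  simp only [tensorForm_apply]
  rw [tensorInner_comm g p (metricAt g p) (hess g h p),
    tensorInner_comm g p (vecMulVec _ _) (hess g h p),
    tensorInner_comm g p (vecMulVec _ _) (metricAt g p), htrace, hdiffTrace, hdiffSq,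
    tensorInner_metricAt_self]
  ring

theorem continuous_tensorInner_solitonTensor_self {s : M → ℝ} (hs : Continuous s) :
    Continuous fun p ↦ tensorInner g p (solitonTensor g m s h p) (solitonTensor g m s h p) := by
  have hgrad := smoothInCharts_grad g hh
  have hhessDiff : (fun p ↦ tensorInner g p (hess g h p) (vecMulVec (diffAt h p) (diffAt h p))) =
      fun p ↦ (divergence g (fun q ↦ normSq g (grad g h) q • grad g h q) p
        - normSq g (grad g h) p * divergence g (grad g h) p) / 2 := by
    funext p
    rw [divergence_normSq_smul_eq g hgrad, hess_eq g hh, diffAt_eq g hh]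
    ring
  have hnormSq := continuous_normSq g hgrad
  have hdiv := continuous_divergence g hgrad
  have hcont : Continuous fun p ↦
      tensorInner g p (hess g h p) (vecMulVec (diffAt h p) (diffAt h p)) := by
    have hdivSmul := continuous_divergence g (hgrad.normSq_smul g)
    rw [hhessDiff]
    fun_prop
  simp only [tensorInner_solitonTensor_self g hh, tensorInner_hess_self g hh]
  have hcovTrace := continuous_covTrace g hgrad hgrad
  fun_prop

end Potential

namespace IsQuasiSoliton

variable {g} {m : ℝ} {s : M → ℝ} {X : VField n M} (hX : IsQuasiSoliton g m s X)
include hX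

theorem tensorInner_covTensor {p : M} {S : Matrix (Fin n) (Fin n) ℝ} (hS : Sᵀ = S) :
    tensorInner g p S (covTensor g X p) =
      (1 / m) * tensorInner g p S (vecMulVec (flat g X p) (flat g X p))
        + s p * tensorInner g p S (metricAt g p) := by
  have hpair := congrArg (tensorForm g p S) (hX.equation p)
  simp only [map_sub, map_smul, smul_eq_mul, tensorForm_apply,
    tensorInner_lieMetric g hX.smooth.smoothInCharts hS] at hpair
  linarith

theorem divergence_eq (p : M) : divergence g X p = (1 / m) * normSq g X p + n * s p := by
  rw [← tensorInner_covTensor_metricAt, tensorInner_comm,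
    hX.tensorInner_covTensor (metricAt_transpose g p), tensorInner_metricAt_flat,
    tensorInner_metricAt_self, mul_comm (s p)]

theorem divergence_normSq_smul_eq (p : M) :
    divergence g (fun q ↦ normSq g X q • X q) p =
      (3 / m) * normSq g X p ^ 2 + (n + 2) * s p * normSq g X p := by
  rw [QuasiYamabe.divergence_normSq_smul_eq g hX.smooth.smoothInCharts, tensorInner_comm,
    hX.tensorInner_covTensor (transpose_vecMulVec _ _), tensorInner_flat_self,
    tensorInner_comm g p _ (metricAt g p), tensorInner_metricAt_flat, hX.divergence_eq]
  ring

theorem continuous_soliton_function (hn : n ≠ 0) : Continuous s := by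
  have hs : s = fun p ↦ (divergence g X p - (1 / m) * normSq g X p) / n := funext fun p ↦ by
    rw [hX.divergence_eq, add_sub_cancel_left, mul_div_cancel_left₀ _ (Nat.cast_ne_zero.2 hn)]
  have hnormSq := continuous_normSq g hX.smooth.smoothInCharts
  have hdiv := continuous_divergence g hX.smooth.smoothInCharts
  rw [hs]
  fun_prop

theorem solitonTensor_eq_zero {h : M → ℝ} (hh : ContMDiff (𝓡 n) 𝓘(ℝ, ℝ) ∞ h) (hXh : X = grad g h)
    (p : M) : solitonTensor g m s h p = 0 := by
  have hhess : (1 / 2 : ℝ) • lieMetric g X p = hess g h p := by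
    rw [hXh, lieMetric_eq g (smoothInCharts_grad g hh), ← hess_eq g hh, hess_transpose g hh]
    module
  rw [solitonTensor, diffAt_eq g hh, ← hhess, ← hXh, hX.equation, sub_self]

end IsQuasiSoliton

section Decomposition

variable {g} {m : ℝ} {s h : M → ℝ} {X Y : VField n M}

theorem IsHodgeDecomposition.covTensor_eq (hXY : IsHodgeDecomposition g X h Y) (p : M) :
    covTensor g X p = hess g h p + covTensor g Y p := by
  rw [funext hXY.decomposition, hess_eq g hXY.smooth_potential]
  exact covTensor_add g (smoothInCharts_grad g hXY.smooth_potential)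
    hXY.smooth_field.smoothInCharts p

theorem IsHodgeDecomposition.divergence_eq (hXY : IsHodgeDecomposition g X h Y) (p : M) :
    divergence g (grad g h) p = divergence g X p := by
  rw [← tensorInner_covTensor_metricAt g X, hXY.covTensor_eq, ← tensorForm_apply, map_add,
    LinearMap.add_apply, tensorForm_apply, tensorForm_apply, tensorInner_covTensor_metricAt g Y,
    hXY.divergence_free, add_zero, hess_eq g hXY.smooth_potential, tensorInner_covTensor_metricAt]

theorem IsHodgeDecomposition.divergence_covField (hXY : IsHodgeDecomposition g X h Y) (p : M) :
    divergence g (covField g (grad g h) Y) p =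
      tensorInner g p (hess g h p) (covTensor g X p) - tensorInner g p (hess g h p) (hess g h p)
        + ricciApply g (grad g h) Y p := by
  have hh := hXY.smooth_potential
  have hcovTrace : covTrace g (grad g h) Y p = tensorInner g p (hess g h p) (covTensor g Y p) := by
    rw [← tensorInner_covTensor_transpose, ← hess_eq g hh, hess_transpose g hh]
  have hdivFree : funRep p (divergence g Y) = fun _ : Model n ↦ (0 : ℝ) :=
    funext fun _ ↦ hXY.divergence_free _
  rw [QuasiYamabe.divergence_covField g (smoothInCharts_grad g hh)
      hXY.smooth_field.smoothInCharts, hcovTrace, hdivFree, hXY.covTensor_eq,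
    ← tensorForm_apply g p _ (_ + _), map_add, tensorForm_apply, tensorForm_apply,
    add_sub_cancel_left]
  simp

theorem gradientIntegrand_eq (hX : IsQuasiSoliton g m s X) (hXY : IsHodgeDecomposition g X h Y)
    (p : M) :
    gradientIntegrand g m s X h Y p =
      tensorInner g p (solitonTensor g m s h p) (solitonTensor g m s h p)
        + divergence g (covField g (grad g h) Y) p
        + (1 / (2 * m)) * divergence g (fun q ↦ normSq g X q • X q) p := by
  have hh := hXY.smooth_potential
  have hm := hX.m_ne_zero
  have htrace : tensorInner g p (hess g h p) (metricAt g p) =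
      (1 / m) * normSq g X p + n * s p := by
    rw [hess_eq g hh, tensorInner_covTensor_metricAt, hXY.divergence_eq, hX.divergence_eq]
  have hdiffSq : tensorInner g p (vecMulVec (diffAt h p) (diffAt h p))
      (vecMulVec (diffAt h p) (diffAt h p)) = normSq g (grad g h) p ^ 2 := by
    rw [diffAt_eq g hh, tensorInner_flat_self]
  rw [gradientIntegrand, tensorInner_solitonTensor_self g hh, hXY.divergence_covField,
    hX.tensorInner_covTensor (hess_transpose g hh p), hX.divergence_normSq_smul_eq,
    hXY.divergence_eq, hX.divergence_eq, htrace, hdiffSq]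
  field_simp
  ring

theorem sq_normSq_sub_le (hX : IsQuasiSoliton g m s X) (hXY : IsHodgeDecomposition g X h Y)
    (p : M) :
    ((normSq g X p - normSq g (grad g h) p) / m) ^ 2 ≤
      n * tensorInner g p (solitonTensor g m s h p) (solitonTensor g m s h p) := by
  have htrace : tensorInner g p (solitonTensor g m s h p) (metricAt g p) =
      (normSq g X p - normSq g (grad g h) p) / m := by
    rw [tensorInner_solitonTensor_metricAt g hXY.smooth_potential, hXY.divergence_eq,
      hX.divergence_eq]
    ring
  exact htrace ▸ sq_tensorInner_metricAt_le g p _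

variable [CompactSpace M] [MeasurableSpace M] [BorelSpace M]

theorem normSq_eq_normSq_grad (hn : n ≠ 0) (hX : IsQuasiSoliton g m s X)
    (hXY : IsHodgeDecomposition g X h Y)
    (hint : ∫ p, tensorInner g p (solitonTensor g m s h p) (solitonTensor g m s h p)
      ∂(riemannianVolume g) ≤ 0) (p : M) :
    normSq g X p = normSq g (grad g h) p := by
  have hzero := eq_zero_of_integral_nonpos g (continuous_tensorInner_solitonTensor_self g
    hXY.smooth_potential m (hX.continuous_soliton_function hn))
    (fun q ↦ tensorInner_self_nonneg g q _) hint p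
  have hsq := sq_normSq_sub_le hX hXY p
  rw [hzero, mul_zero] at hsq
  have hquot := pow_eq_zero_iff two_ne_zero |>.1 (le_antisymm hsq (sq_nonneg _))
  exact sub_eq_zero.1 ((div_eq_zero_iff.1 hquot).resolve_right hX.m_ne_zero)

theorem eq_zero_of_integral_normSq_eq_zero (hY : SmoothInCharts Y)
    (hint : ∫ p, normSq g Y p ∂(riemannianVolume g) = 0) (p : M) : Y p = 0 := by
  have hnonneg : ∀ p, 0 ≤ normSq g Y p := fun p ↦ by
    by_cases hp : Y p = 0
    · simp [normSq, hp]
    · exact (g.pos p _ hp).le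
  by_contra hp
  exact (g.pos p _ hp).ne'
    (eq_zero_of_integral_nonpos g (continuous_normSq g hY) hnonneg hint.le p)

variable [T2Space M]

theorem integral_inner_grad_eq_zero {f : M → ℝ} (hf : ContMDiff (𝓡 n) 𝓘(ℝ, ℝ) ∞ f)
    (hY : SmoothInCharts Y) (hdiv : ∀ p, divergence g Y p = 0) :
    ∫ p, g.inner p (grad g f p) (Y p) ∂(riemannianVolume g) = 0 := by
  rw [← integral_divergence_eq_zero g (SmoothInCharts.smul (smoothFunInCharts_of_contMDiff hf) hY)]
  refine integral_congr_ae (Eventually.of_forall fun p ↦ ?_)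
  simp only [divergence_smul_of_contMDiff g hf hY, hdiv, mul_zero, add_zero]

theorem integral_gradientIntegrand (hn : n ≠ 0) (hX : IsQuasiSoliton g m s X)
    (hXY : IsHodgeDecomposition g X h Y) :
    ∫ p, gradientIntegrand g m s X h Y p ∂(riemannianVolume g) =
      ∫ p, tensorInner g p (solitonTensor g m s h p) (solitonTensor g m s h p)
        ∂(riemannianVolume g) := by
  have hcov := (smoothInCharts_grad g hXY.smooth_potential).covField g
    hXY.smooth_field.smoothInCharts
  have hcubic := hX.smooth.smoothInCharts.normSq_smul g
  have hintTensor := integrable_of_continuous g (continuous_tensorInner_solitonTensor_self g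
    hXY.smooth_potential m (hX.continuous_soliton_function hn))
  have hintCov := integrable_of_continuous g (continuous_divergence g hcov)
  have hintCubic := integrable_of_continuous g (continuous_divergence g hcubic)
  simp only [gradientIntegrand_eq hX hXY]
  rw [integral_add (hintTensor.fun_add hintCov) (hintCubic.const_mul _),
    integral_add hintTensor hintCov, integral_const_mul, integral_divergence_eq_zero g hcov,
    integral_divergence_eq_zero g hcubic, mul_zero, add_zero, add_zero]

theorem IsHodgeDecomposition.eq_zero_of_normSq_eq (hXY : IsHodgeDecomposition g X h Y)
    (hnormSq : ∀ p, normSq g X p = normSq g (grad g h) p) (p : M) : Y p = 0 := by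
  have hY := hXY.smooth_field.smoothInCharts
  have hexpand : ∀ p, normSq g Y p = -2 * g.inner p (grad g h p) (Y p) := fun p ↦ by
    have hpolar := hnormSq p
    simp only [normSq, hXY.decomposition p, map_add, _root_.add_apply] at hpolar
    rw [g.symm p (Y p) (grad g h p)] at hpolar
    rw [normSq]
    linarith
  refine eq_zero_of_integral_normSq_eq_zero (g := g) hY ?_ p
  simp only [hexpand]
  rw [integral_const_mul, integral_inner_grad_eq_zero hXY.smooth_potential hY
    hXY.divergence_free, mul_zero]

theorem IsHodgeDecomposition.eq_zero_of_isGradientField (hXY : IsHodgeDecomposition g X h Y)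
    (hX : IsGradientField g X) (p : M) : Y p = 0 := by
  obtain ⟨f, hf, hXf⟩ := hX
  have hY := hXY.smooth_field.smoothInCharts
  have hintegrable : ∀ {u : M → ℝ}, ContMDiff (𝓡 n) 𝓘(ℝ, ℝ) ∞ u →
      Integrable (fun q ↦ g.inner q (grad g u q) (Y q)) (riemannianVolume g) := fun hu ↦
    integrable_of_continuous g (smoothFunInCharts_inner g (smoothInCharts_grad g hu) hY).continuous
  have hnormSq : ∀ q, normSq g Y q =
      g.inner q (grad g f q) (Y q) - g.inner q (grad g h q) (Y q) := fun q ↦ by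
    have hsub : Y q = grad g f q - grad g h q := by
      rw [← hXf q, hXY.decomposition q, add_sub_cancel_left]
    rw [normSq, ← _root_.sub_apply, ← map_sub, ← hsub]
  refine eq_zero_of_integral_normSq_eq_zero (g := g) hY ?_ p
  simp only [hnormSq]
  rw [integral_sub (hintegrable hf) (hintegrable hXY.smooth_potential),
    integral_inner_grad_eq_zero hf hY hXY.divergence_free,
    integral_inner_grad_eq_zero hXY.smooth_potential hY hXY.divergence_free, sub_zero]

end Decomposition

end Soliton

end QuasiYamabe

end

theorem theorem1p2_general {n : ℕ} (hn : n ≠ 0)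
    {M : Type*} [TopologicalSpace M] [ChartedSpace (Model n) M] [IsManifold (𝓡 n) ∞ M]
    [T2Space M] [CompactSpace M] [MeasurableSpace M] [BorelSpace M] (g : Metric n M)
    (m : ℝ) (s : M → ℝ) (X : VField n M) (hX : IsQuasiSoliton g m s X)
    (h : M → ℝ) (Y : VField n M) (hXY : IsHodgeDecomposition g X h Y) :
    IsGradientField g X ↔
      ∫ p, gradientIntegrand g m s X h Y p ∂(riemannianVolume g) ≤ 0 := by
  rw [integral_gradientIntegrand hn hX hXY]
  constructor
  · intro hgrad
    have hXh : X = grad g h := funext fun p ↦ by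
      rw [hXY.decomposition p, hXY.eq_zero_of_isGradientField hgrad p, add_zero]
    have hzero : ∀ p, tensorInner g p (solitonTensor g m s h p) (solitonTensor g m s h p) = 0 :=
      fun p ↦ by
        rw [hX.solitonTensor_eq_zero hXY.smooth_potential hXh, ← tensorForm_apply, map_zero]
    simp only [hzero, integral_zero, le_refl]
  · intro hint
    have hY := hXY.eq_zero_of_normSq_eq (normSq_eq_normSq_grad hn hX hXY hint)
    exact ⟨h, hXY.smooth_potential, fun p ↦ by rw [hXY.decomposition p, hY p, add_zero]⟩

theorem theorem1p2 {n : ℕ} (hn : 3 ≤ n)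
    {M : Type*} [TopologicalSpace M] [ChartedSpace (EuclideanSpace ℝ (Fin n)) M]
    [IsManifold (𝓡 n) ∞ M] [T2Space M] [CompactSpace M] [MeasurableSpace M] [BorelSpace M]
    (g : ContMDiffRiemannianMetric (𝓡 n) ∞ (EuclideanSpace ℝ (Fin n))
      (fun x : M ↦ TangentSpace (𝓡 n) x))
    (k : ℕ) (hk : 1 ≤ k) (hkn : k ≤ n) (m lam : ℝ)
    (X : (x : M) → TangentSpace (𝓡 n) x) (hX : IsQuasiYamabeSoliton g k m lam X)
    (h : M → ℝ) (Y : (x : M) → TangentSpace (𝓡 n) x) (hXY : IsHodgeDecomposition g X h Y) :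
    IsGradientField g X ↔
      ∫ p, (ricciApply g (grad g h) Y p
        + (1 / m) * tensorInner g p (hess g h p) (Matrix.vecMulVec (flat g X p) (flat g X p))
        - (2 / m) * tensorInner g p (hess g h p) (Matrix.vecMulVec (diffAt h p) (diffAt h p))
        + (1 / m ^ 2) * tensorInner g p (Matrix.vecMulVec (diffAt h p) (diffAt h p))
            (Matrix.vecMulVec (diffAt h p) (diffAt h p))
        + (n / (2 * m)) * (sigma g k p - lam) * normSq g X p
        + (2 / m) * (sigma g k p - lam) * normSq g (grad g h) p
        + (3 / (2 * m ^ 2)) * (normSq g X p) ^ 2) ∂(riemannianVolume g) ≤ 0 :=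
  theorem1p2_general (by omega) g m (fun p ↦ sigma g k p - lam) X
    ⟨hX.m_ne_zero, hX.smooth, hX.equation⟩ h Y hXY
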